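/- For $d\ge 0$ let $\mathcal P_d$ be the real vector space of polynomials $a_0+a_1x+\dots+a_dx^d$ with real coefficients, of degree at most $d$, with the Euclidean norm $\|p\|=(a_0^2+\dots+a_d^2)^{1/2}$, and let $S^d=\{p\in\mathcal P_d : \|p\|=1\}$ be its unit sphere, oriented as the boundary of the unit ball (for $d=0$: the point $1$ is positive and the point $-1$ is negative). Products of spheres carry the product orientation. Since a product of nonzero polynomials is nonzero, multiplication of polynomials followed by radial projection defines a map $$\hat\mu_{m,n}: S^m\times S^n\longrightarrow S^{m+n},\qquad \hat\mu_{m,n}(p,q)=\frac{p\cdot q}{\|p\cdot q\|}.$$ A smooth map $f:S^m\times S^n\to S^{m+n}$ has mapping degree $D\in\mathbb Z$ if it has a regular value and if, for every regular value $y$ of $f$, the fibre $f^{-1}(y)$ is finite and the number of its points, each counted with sign $+1$ or $-1$ according to whether the differential of $f$ at that point preserves or reverses orientation, is equal to $D$. **Proposition.** Let $m=2k$ and $n=2l$ be even integers, $k,l\ge 0$. Then $\hat\mu_{m,n}$ is smooth, and its mapping degree is $$\deg(\hat\mu_{m,n})=\pm\,2\binom{k+l}{k}.$$ -/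

import Mathlib

open scoped Manifold ContDiff

noncomputable section

/-! ## Mapping degree of maps from a product of two spheres to a sphere -/

/-- The unit sphere `S^d` in `ℝ^(d+1)`, with Mathlib's smooth structure. -/
abbrev USphere (d : ℕ) : Type := Metric.sphere (0 : EuclideanSpace ℝ (Fin (d + 1))) 1

/-- The orientation of `S^d` as the boundary of the unit ball (outward normal first): a family
`v` of `d` tangent vectors at `x` has sign `1` (`-1`) if it is a positively (negatively) oriented
basis of the tangent space, that is, if the determinant of `(x, v 0, …, v (d-1))` is positive
(negative), and it has sign `0` if it is not a basis. For `d = 0` this gives the point `1` the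
sign `1` and the point `-1` the sign `-1`. -/
def frameSign {d : ℕ} (x : USphere d) (v : Fin d → TangentSpace (𝓡 d) x) : ℤ :=
  SignType.sign ((EuclideanSpace.basisFun (Fin (d + 1)) ℝ).toBasis.det
    (Fin.cons (x : EuclideanSpace ℝ (Fin (d + 1)))
      (fun i => mvfderiv (𝓡 d)
        (fun z : USphere d => (z : EuclideanSpace ℝ (Fin (d + 1)))) x (v i))))

/-- The basis of the tangent space of `S^d` at `x` given by the preferred chart at `x`. -/
def chartFrame {d : ℕ} (x : USphere d) : Fin d → TangentSpace (𝓡 d) x :=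
  fun i => (EuclideanSpace.single i (1 : ℝ) : EuclideanSpace ℝ (Fin d))

/-- The differential of `f : S^m × S^n → N` at `(x, y)` as a map from pairs of tangent vectors. -/
abbrev prodDeriv {m n d : ℕ} (f : USphere m × USphere n → USphere d) (z : USphere m × USphere n)
    (v : TangentSpace (𝓡 m) z.1) (w : TangentSpace (𝓡 n) z.2) : TangentSpace (𝓡 d) (f z) :=
  mfderiv ((𝓡 m).prod (𝓡 n)) (𝓡 d) f z (v, w)

/-- The local degree of `f : S^m × S^n → S^(m+n)` at `z`: it is `1` if the differential of `f`
at `z` is an orientation preserving isomorphism, `-1` if it is an orientation reversing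
isomorphism, and `0` if it is not an isomorphism. The product carries the product orientation:
the sign of the basis `((v₁, 0), …, (vₘ, 0), (0, w₁), …, (0, wₙ))` is the product of the signs of
`v` and `w`. The sign of this basis is compared with that of its image; this does not depend
on the bases `v` and `w`. -/
def localDegree {m n : ℕ} (f : USphere m × USphere n → USphere (m + n))
    (z : USphere m × USphere n) : ℤ :=
  frameSign z.1 (chartFrame z.1) * frameSign z.2 (chartFrame z.2) *
    frameSign (f z) (Fin.append
      (fun i => prodDeriv f z (chartFrame z.1 i) 0)
      (fun j => prodDeriv f z 0 (chartFrame z.2 j)))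

/-- `y` is a regular value of `f`: the differential is onto at every point of the fibre. -/
def IsRegValue {m n : ℕ} (f : USphere m × USphere n → USphere (m + n))
    (y : USphere (m + n)) : Prop :=
  ∀ z, f z = y →
    Function.Surjective (mfderiv ((𝓡 m).prod (𝓡 n)) (𝓡 (m + n)) f z)

/-- The map `f : S^m × S^n → S^(m+n)` is smooth and has mapping degree `D`: regular values exist,
and for each of them the algebraic number of points of the fibre (which is finite) is `D`. -/
structure HasMappingDegree {m n : ℕ} (f : USphere m × USphere n → USphere (m + n)) (D : ℤ) :
    Prop where
  smooth : ContMDiff ((𝓡 m).prod (𝓡 n)) (𝓡 (m + n)) ∞ f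
  exists_regular : ∃ y, IsRegValue f y
  finite_fibre : ∀ y, IsRegValue f y → (f ⁻¹' {y}).Finite
  count : ∀ y, IsRegValue f y → ∑ᶠ z ∈ f ⁻¹' {y}, localDegree f z = D

/-! ## Multiplication of polynomials -/

/-- The polynomial `a₀ + a₁ X + … + a_m X^m` of degree at most `m` with coefficient vector `a`. -/
def polyOfCoeffs {m : ℕ} (a : EuclideanSpace ℝ (Fin (m + 1))) : Polynomial ℝ :=
  ∑ i : Fin (m + 1), Polynomial.monomial (i : ℕ) (a i)

/-- Multiplication of polynomials of degrees at most `m` and `n`, in coefficients. -/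
def polyMul {m n : ℕ} (a : EuclideanSpace ℝ (Fin (m + 1))) (b : EuclideanSpace ℝ (Fin (n + 1))) :
    EuclideanSpace ℝ (Fin (m + n + 1)) :=
  WithLp.toLp 2 fun i => (polyOfCoeffs a * polyOfCoeffs b).coeff i

theorem polyOfCoeffs_coeff {m : ℕ} (a : EuclideanSpace ℝ (Fin (m + 1))) (i : Fin (m + 1)) :
    (polyOfCoeffs a).coeff i = a i := by
  simp [polyOfCoeffs, Polynomial.coeff_monomial, Fin.val_inj]

theorem polyOfCoeffs_ne_zero {m : ℕ} {a : EuclideanSpace ℝ (Fin (m + 1))} (ha : a ≠ 0) :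
    polyOfCoeffs a ≠ 0 := by
  intro h
  apply ha
  ext i
  rw [← polyOfCoeffs_coeff a i, h]
  simp

theorem polyOfCoeffs_natDegree_le {m : ℕ} (a : EuclideanSpace ℝ (Fin (m + 1))) :
    (polyOfCoeffs a).natDegree ≤ m :=
  Polynomial.natDegree_sum_le_of_forall_le _ _ fun i _ =>
    (Polynomial.natDegree_monomial_le _).trans (Nat.lt_succ_iff.1 i.2)

/-- The product of nonzero polynomials is nonzero. -/
theorem polyMul_ne_zero {m n : ℕ} {a : EuclideanSpace ℝ (Fin (m + 1))}
    {b : EuclideanSpace ℝ (Fin (n + 1))} (ha : a ≠ 0) (hb : b ≠ 0) : polyMul a b ≠ 0 := by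
  intro h
  refine mul_ne_zero (polyOfCoeffs_ne_zero ha) (polyOfCoeffs_ne_zero hb) ?_
  ext i
  by_cases hi : i < m + n + 1
  · have := congrArg (fun v : EuclideanSpace ℝ (Fin (m + n + 1)) => v ⟨i, hi⟩) h
    simpa [polyMul] using this
  · rw [Polynomial.coeff_zero]
    apply Polynomial.coeff_eq_zero_of_natDegree_lt
    have h1 := polyOfCoeffs_natDegree_le a
    have h2 := polyOfCoeffs_natDegree_le b
    have h3 := Polynomial.natDegree_mul_le (p := polyOfCoeffs a) (q := polyOfCoeffs b)
    omega

/-- Radial projection of a nonzero vector to the unit sphere. -/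
def radialProj {d : ℕ} (v : EuclideanSpace ℝ (Fin (d + 1))) (hv : v ≠ 0) : USphere d :=
  ⟨‖v‖⁻¹ • v, by simp [norm_smul, hv]⟩

/-- The map `S^m × S^n → S^(m+n)`, `(p, q) ↦ (p * q) / ‖p * q‖`. -/
def mulSphere (m n : ℕ) (z : USphere m × USphere n) : USphere (m + n) :=
  radialProj (polyMul (z.1 : EuclideanSpace ℝ (Fin (m + 1))) z.2)
    (polyMul_ne_zero (ne_zero_of_mem_unit_sphere z.1) (ne_zero_of_mem_unit_sphere z.2))

end

open scoped Manifold ContDiff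

noncomputable section

open Polynomial Filter

/-! ## Real polynomials -/

/-! The differential of multiplication at `(x, y)` sends `(u, w)` to `u * y + x * w`, up to a
positive factor and a multiple of `x * y`. If `a` and `b` are tangent frames, the determinant of `(x
* y, aᵢ * y, x * bⱼ)` is a constant sign times `det (x, a) * det (y, b) * Res (x, y)`
(`det_productFrame`). So the local degree is, up to that sign, the sign of the resultant
(`localDegree_mulSphere`), and a value is regular exactly when no point of its fibre has vanishing
resultant.

Given a value `y`, pick `t` with `y(t) ≠ 0` and move `t` to infinity by `X ↦ 1 / X + t`. All factors
then have full degree and can be made monic; as both degrees are even, the signs of the resultants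
change by one common constant. The fibre becomes two antipodal copies, with equal signs, of the set
of monic factorizations `f = P * Q` with `deg P = 2k` (`bijOn_monicShift`, `fibre_eq_union`).

It remains to count these with the sign of `Res (P, Q)` (`sum_sign_resultant_monicFactorPairs`).
Write `f` as a product of `k + l` quadratics `T i`, pairing conjugate roots and consecutive real
roots; their mutual resultants are nonnegative. A factorization that keeps every `T i` in one factor
is a choice of `k` quadratics and counts `+1`. In any other, exchanging the two roots of the first
split `T i` reverses the sign, so these cancel. The count is `(k + l).choose k`, and the antipodes
double it. Only coprimality of the factorizations is available: a regular value may still have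
multiple roots. -/

theorem isRoot_of_odd_natDegree {f : ℝ[X]} (hf : f.Monic) (h : Odd f.natDegree) :
    ∃ x, f.IsRoot x := by
  have hd : 0 < f.degree := natDegree_pos_iff_degree_pos.1 h.pos
  have h1 := f.tendsto_atTop_of_leadingCoeff_nonneg hd (by simp [hf.leadingCoeff])
  have h2 := (f.comp (-X)).tendsto_atBot_of_leadingCoeff_nonpos
    (natDegree_pos_iff_degree_pos.1 (by simpa [natDegree_comp] using h.pos))
    (by simp [leadingCoeff_comp, hf.leadingCoeff, h.neg_one_pow])
  obtain ⟨u, hu⟩ := (h1.eventually_ge_atTop 0).exists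
  obtain ⟨v, hv⟩ := (h2.eventually_le_atBot 0).exists
  simp only [eval_comp, eval_neg, eval_X] at hv
  exact mem_range_of_exists_le_of_exists_ge f.continuous ⟨_, hv⟩ ⟨_, hu⟩

/-- A monic real polynomial of even positive degree is nonnegative to the left of its roots. -/
theorem eval_nonneg_of_le_roots {f : ℝ[X]} (hf : f.Monic) (h0 : 0 < f.natDegree)
    (h : Even f.natDegree) {x : ℝ} (hx : ∀ r, f.IsRoot r → x ≤ r) : 0 ≤ f.eval x := by
  by_contra! hlt
  -- Even degree makes `f` tend to `+∞` at `-∞`, so a negative value at `x` would force a root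
  -- strictly to the left of `x`.
  have h2 := (f.comp (-X)).tendsto_atTop_of_leadingCoeff_nonneg
    (natDegree_pos_iff_degree_pos.1 (by simpa [natDegree_comp] using h0))
    (by simp [leadingCoeff_comp, hf.leadingCoeff, h.neg_one_pow])
  obtain ⟨u, hu, hu'⟩ := ((h2.eventually_ge_atTop 0).and (eventually_ge_atTop (-x))).exists
  simp only [eval_comp, eval_neg, eval_X] at hu
  obtain ⟨y, hy, hy'⟩ := intermediate_value_Icc' (show -u ≤ x by linarith)
    f.continuous.continuousOn ⟨hlt.le, hu⟩
  have := hx y hy'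
  have : y = x := le_antisymm hy.2 this
  subst this
  simp only at hy'
  linarith

/-- Real irreducible polynomials have degree at most two, and an irreducible factor of degree one
would supply a root. -/
theorem exists_isRoot_or_exists_quadratic {f : ℝ[X]} (hf : 0 < f.natDegree) :
    (∃ x, f.IsRoot x) ∨
      ∃ g : ℝ[X], g.Monic ∧ g.natDegree = 2 ∧ g ∣ f ∧ ∀ x, ¬ g.IsRoot x := by
  by_cases hr : ∃ x, f.IsRoot x
  · exact Or.inl hr
  push Not at hr
  obtain ⟨g, hg, hgi, hgf⟩ := exists_monic_irreducible_factor f (not_isUnit_of_natDegree_pos f hf)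
  have hg0 : ∀ x, ¬ g.IsRoot x := fun x hx => hr x (hx.dvd hgf)
  refine Or.inr ⟨g, hg, ?_, hgf, hg0⟩
  have h1 := hgi.natDegree_le_two
  have h2 : g.natDegree ≠ 1 := fun h => by
    obtain ⟨x, hx⟩ := isRoot_of_odd_natDegree hg (by rw [h]; exact odd_one)
    exact hg0 x hx
  have h3 := hgi.natDegree_pos
  omega

theorem exists_eq_X_sub_C_mul_X_sub_C {f : ℝ[X]} (hf : f.Monic) (h2 : f.natDegree = 2) {a : ℝ}
    (ha : f.IsRoot a) : ∃ b, f = (X - C a) * (X - C b) := by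
  obtain ⟨g, rfl⟩ := dvd_iff_isRoot.2 ha
  have hg : g.Monic := (monic_X_sub_C a).of_mul_monic_left hf
  rw [(monic_X_sub_C a).natDegree_mul hg, natDegree_X_sub_C] at h2
  refine ⟨-g.coeff 0, ?_⟩
  congr 1
  have := hg.as_sum
  rw [show g.natDegree = 1 by omega] at this
  rw [this]
  simp

theorem exists_sq_add_sq_of_forall_not_isRoot {f : ℝ[X]} (hf : f.Monic) (h2 : f.natDegree = 2)
    (h : ∀ x, ¬ f.IsRoot x) : ∃ c d : ℝ, f = (X - C c) ^ 2 + C (d ^ 2) := by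
  have hs := hf.as_sum
  rw [h2] at hs
  simp only [Finset.sum_range_succ, Finset.sum_range_zero, pow_zero, pow_one, mul_one,
    zero_add] at hs
  set u := f.coeff 1
  set v := f.coeff 0
  have hpos : 0 ≤ v - u ^ 2 / 4 := by
    by_contra! hneg
    refine h (-u / 2 + √(u ^ 2 / 4 - v)) ?_
    have := Real.sq_sqrt (show 0 ≤ u ^ 2 / 4 - v by linarith)
    rw [IsRoot, hs]
    simp only [eval_add, eval_pow, eval_X, eval_C, eval_mul]
    ring_nf at this ⊢
    linarith
  refine ⟨-u / 2, √(v - u ^ 2 / 4), ?_⟩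
  rw [Real.sq_sqrt hpos, hs]
  refine Polynomial.funext fun x => ?_
  simp only [eval_add, eval_pow, eval_X, eval_C, eval_mul, eval_sub]
  ring

/-! ## Signs of resultants -/

/-- Over `ℂ` the quadratic is `(X - α) * (X - conj α)`, so the resultant is `g(α) * g(conj α) =
|g(α)|²`. -/
theorem resultant_nonneg_of_forall_not_isRoot {f : ℝ[X]} (hf : f.Monic) (h2 : f.natDegree = 2)
    (h : ∀ x, ¬ f.IsRoot x) (g : ℝ[X]) : 0 ≤ resultant f g := by
  obtain ⟨c, d, rfl⟩ := exists_sq_add_sq_of_forall_not_isRoot hf h2 h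
  set α : ℂ := c + d * Complex.I with hα
  have hm : ((X - C c) ^ 2 + C (d ^ 2) : ℝ[X]).map (algebraMap ℝ ℂ) =
      (X - C α) * (X - C ((starRingEnd ℂ) α)) := by
    refine Polynomial.funext fun x => ?_
    have := Complex.I_sq
    simp only [hα, Polynomial.map_add, Polynomial.map_pow, Polynomial.map_sub, map_X, map_C,
      eval_add, eval_pow, eval_X, eval_C, eval_mul, eval_sub, map_add, map_mul, Complex.conj_ofReal,
      Complex.conj_I, Complex.coe_algebraMap, Complex.ofReal_pow]
    linear_combination ((d : ℂ) ^ 2) * this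
  have hr := resultant_map_map ((X - C c) ^ 2 + C (d ^ 2) : ℝ[X]) g 2 g.natDegree (algebraMap ℝ ℂ)
  have hdeg : (g.map (algebraMap ℝ ℂ)).natDegree ≤ g.natDegree := natDegree_map_le
  have hmul := resultant_mul_left (X - C α) (X - C ((starRingEnd ℂ) α)) (g.map (algebraMap ℝ ℂ))
    g.natDegree hdeg
  simp only [natDegree_X_sub_C, resultant_X_sub_C_left _ _ _ hdeg] at hmul
  have hr2 : resultant ((X - C α) * (X - C ((starRingEnd ℂ) α))) (g.map (algebraMap ℝ ℂ)) 2
      g.natDegree = _ := hmul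
  rw [hm, hr2] at hr
  have hconj : eval ((starRingEnd ℂ) α) (g.map (algebraMap ℝ ℂ)) =
      (starRingEnd ℂ) (eval α (g.map (algebraMap ℝ ℂ))) := by
    rw [eval_map, eval_map, hom_eval₂]
    congr 1
    ext x
    simp
  rw [hconj, Complex.mul_conj] at hr
  rw [h2]
  have : Complex.normSq (eval α (g.map (algebraMap ℝ ℂ))) =
    resultant ((X - C c) ^ 2 + C (d ^ 2) : ℝ[X]) g 2 g.natDegree := Complex.ofReal_injective hr
  rw [← this]
  exact Complex.normSq_nonneg _

theorem resultant_X_sub_C_mul_X_sub_C (a b : ℝ) (g : ℝ[X]) :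
    resultant ((X - C a) * (X - C b)) g = g.eval a * g.eval b := by
  have := resultant_mul_left (X - C a) (X - C b) g g.natDegree le_rfl
  simp only [natDegree_X_sub_C, resultant_X_sub_C_left _ _ _ le_rfl] at this
  rw [(monic_X_sub_C a).natDegree_mul (monic_X_sub_C b)]
  simpa using this

theorem resultant_symm_of_even {f g : ℝ[X]} (h : Even f.natDegree) :
    resultant f g = resultant g f := by
  rw [resultant_comm, (h.mul_right _).neg_one_pow, one_mul]

/-- A monic real polynomial of degree `2 * N` is a product of `N` monic quadratic polynomials with
pairwise nonnegative resultants: consecutive real roots and conjugate complex roots are paired. -/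
theorem exists_prod_quadratic_eq (N : ℕ) {f : ℝ[X]} (hf : f.Monic) (hN : f.natDegree = 2 * N) :
    ∃ T : Fin N → ℝ[X], (∀ i, (T i).Monic) ∧ (∀ i, (T i).natDegree = 2) ∧ ∏ i, T i = f ∧
      ∀ i j, i ≠ j → 0 ≤ resultant (T i) (T j) := by
  induction N generalizing f with
  | zero =>
    exact ⟨Fin.elim0, fun i => i.elim0, fun i => i.elim0,
      by simp [eq_one_of_monic_natDegree_zero hf (by simpa using hN)], fun i => i.elim0⟩
  | succ N ih =>
    -- The induction needs `t` to be compatible with every monic quadratic divisor of the cofactor,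
    -- since the induction hypothesis does not say which quadratics it produces.
    suffices H : ∃ t g : ℝ[X], t.Monic ∧ t.natDegree = 2 ∧ f = t * g ∧
        ∀ s : ℝ[X], s.Monic → s.natDegree = 2 → s ∣ g → 0 ≤ resultant t s by
      obtain ⟨t, g, ht, ht2, rfl, hts⟩ := H
      have hg : g.Monic := ht.of_mul_monic_left hf
      rw [ht.natDegree_mul hg] at hN
      obtain ⟨T, hT, hT2, hTg, hTr⟩ := ih hg (by omega)
      have hd : ∀ j, 0 ≤ resultant t (T j) := fun j =>
        hts _ (hT j) (hT2 j) (hTg ▸ Finset.dvd_prod_of_mem T (Finset.mem_univ j))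
      refine ⟨Fin.cons t T, fun i => ?_, fun i => ?_, ?_, fun i j hij => ?_⟩
      · cases i using Fin.cases <;> simp [ht, hT]
      · cases i using Fin.cases <;> simp [ht2, hT2]
      · simp [Fin.prod_univ_succ, hTg]
      · cases i using Fin.cases with
        | zero =>
          cases j using Fin.cases with
          | zero => exact absurd rfl hij
          | succ j => exact hd j
        | succ i =>
          cases j using Fin.cases with
          | zero =>
            change 0 ≤ resultant (T i) t
            rw [resultant_symm_of_even (by simp [hT2])]
            exact hd i
          | succ j => exact hTr i j fun h => hij (by rw [h])
    rcases exists_isRoot_or_exists_quadratic (f := f) (by omega) with ⟨x, hx⟩ | ⟨t, ht, ht2, ⟨g, hg⟩, ht0⟩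
    · have min_root : ∀ g : ℝ[X], g ≠ 0 → (∃ x, g.IsRoot x) →
          ∃ x, g.IsRoot x ∧ ∀ y, g.IsRoot y → x ≤ y := fun g hg ⟨x, hx⟩ => by
        obtain ⟨a, ha, ha'⟩ := g.roots.toFinset.exists_min_image id
          ⟨x, by simpa [hg] using hx⟩
        exact ⟨a, by simpa [hg] using ha, fun y hy => ha' y (by simpa [hg] using hy)⟩
      -- The two smallest real roots `a ≤ b`, with multiplicity, are paired; `b` exists because the
      -- cofactor has odd degree. No root of `g` lies below `b`, so monic quadratic divisors of `g`
      -- are nonnegative at both.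
      obtain ⟨a, ha, hamin⟩ := min_root f hf.ne_zero ⟨x, hx⟩
      obtain ⟨f₁, rfl⟩ := dvd_iff_isRoot.2 ha
      have hf₁ : f₁.Monic := (monic_X_sub_C a).of_mul_monic_left hf
      rw [(monic_X_sub_C a).natDegree_mul hf₁, natDegree_X_sub_C] at hN
      obtain ⟨b, hb, hbmin⟩ := min_root f₁ hf₁.ne_zero
        (isRoot_of_odd_natDegree hf₁ ⟨N, by omega⟩)
      obtain ⟨g, rfl⟩ := dvd_iff_isRoot.2 hb
      have hab : a ≤ b := hamin b (hb.dvd (dvd_mul_left _ _))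
      refine ⟨(X - C a) * (X - C b), g, (monic_X_sub_C a).mul (monic_X_sub_C b), ?_, by ring, ?_⟩
      · rw [(monic_X_sub_C a).natDegree_mul (monic_X_sub_C b)]; simp
      · intro s hs hs2 hsg
        have key : ∀ r, s.IsRoot r → b ≤ r := fun r hr => hbmin r ((hr.dvd hsg).dvd (dvd_mul_left _ _))
        rw [resultant_X_sub_C_mul_X_sub_C]
        exact mul_nonneg
          (eval_nonneg_of_le_roots hs (by omega) (by simp [hs2]) fun r hr => hab.trans (key r hr))
          (eval_nonneg_of_le_roots hs (by omega) (by simp [hs2]) key)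
    · exact ⟨t, g, ht, ht2, hg, fun s _ _ _ => resultant_nonneg_of_forall_not_isRoot ht ht2 ht0 s⟩

/-- Exchanging a root of `p` with a root of `q` reverses the sign of the resultant if the
cofactor has the same sign at both roots. -/
theorem resultant_mul_resultant_swap_nonpos {a b : ℝ} {p q : ℝ[X]} (hp : p.Monic) (hq : q.Monic)
    (h : 0 ≤ (p * q).eval a * (p * q).eval b) :
    resultant ((X - C a) * p) ((X - C b) * q) * resultant ((X - C b) * p) ((X - C a) * q) ≤ 0 := by
  -- Multiplicativity isolates the antisymmetric factor `a - b`. In the product of the two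
  -- resultants the evaluations combine to the cofactor `p * q` at `a` and at `b`; everything else
  -- is a square.
  have key : ∀ a b : ℝ, resultant ((X - C a) * p) ((X - C b) * q) =
      (a - b) * q.eval a * ((-1) ^ p.natDegree * p.eval b) * resultant p q := fun a b => by
    have h1 := resultant_mul_left (X - C a) p ((X - C b) * q) _ le_rfl
    rw [← (monic_X_sub_C a).natDegree_mul hp, natDegree_X_sub_C,
      resultant_X_sub_C_left _ _ _ le_rfl] at h1
    have h2 := resultant_mul_right p (X - C b) q _ le_rfl
    rw [← (monic_X_sub_C b).natDegree_mul hq, natDegree_X_sub_C,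
      resultant_X_sub_C_right _ _ _ le_rfl] at h2
    rw [h1, h2]
    simp only [eval_mul, eval_sub, eval_X, eval_C]
    ring
  rw [key a b, key b a]
  simp only [eval_mul] at h
  have h1 : ((-1 : ℝ) ^ p.natDegree) ^ 2 = 1 := by rw [← pow_mul, mul_comm, pow_mul]; simp
  have : (a - b) * q.eval a * ((-1) ^ p.natDegree * p.eval b) * resultant p q *
      ((b - a) * q.eval b * ((-1) ^ p.natDegree * p.eval a) * resultant p q) =
      -((a - b) ^ 2 * resultant p q ^ 2 * (p.eval a * q.eval a * (p.eval b * q.eval b))) *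
        ((-1 : ℝ) ^ p.natDegree) ^ 2 := by ring
  rw [this, h1, mul_one, neg_nonpos]
  exact mul_nonneg (by positivity) h

/-! ## Counting monic factorizations with the sign of the resultant -/

/-- A sum vanishes if its index set carries a symmetric functional relation under which the terms
cancel. -/
theorem sum_eq_zero_of_cancelling_relation {ι : Type*} (s : Finset ι) (f : ι → ℤ) (R : ι → ι → Prop)
    (hex : ∀ x ∈ s, ∃ y ∈ s, R x y) (hsymm : ∀ x y, R x y → R y x)
    (huniq : ∀ x ∈ s, ∀ y y', R x y → R x y' → y = y')
    (hf : ∀ x ∈ s, ∀ y ∈ s, R x y → f x + f y = 0) : ∑ x ∈ s, f x = 0 := by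
  classical
  -- Uniqueness and symmetry make the chosen partner an involution; at a fixed point the term equals
  -- its own negative, hence is zero.
  choose! g hgs hgR using hex
  refine Finset.sum_involution (fun x _ => g x) (fun x hx => hf x hx _ (hgs x hx) (hgR x hx))
    (fun x hx h0 h => h0 ?_) (fun x hx => hgs x hx)
    (fun x hx => huniq _ (hgs x hx) _ _ (hgR _ (hgs x hx)) (hsymm _ _ (hgR x hx)))
  have := hf x hx _ (hgs x hx) (hgR x hx)
  rw [h] at this
  omega

/-- The factorizations of `f` into two monic factors, the first of degree `m`. -/
def monicFactorPairs (f : ℝ[X]) (m : ℕ) : Set (ℝ[X] × ℝ[X]) :=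
  {d | d.1.Monic ∧ d.2.Monic ∧ d.1 * d.2 = f ∧ d.1.natDegree = m}

/-- The irreducible factors of the first component form a submultiset of those of `f`; they
determine the monic first factor, hence also the second. -/
theorem finite_monicFactorPairs {f : ℝ[X]} (hf : f ≠ 0) (m : ℕ) :
    (monicFactorPairs f m).Finite := by
  classical
  refine Set.Finite.of_injOn (f := fun d => UniqueFactorizationMonoid.normalizedFactors d.1)
    (t := Set.Iic (UniqueFactorizationMonoid.normalizedFactors f)) ?_ ?_ (Set.finite_Iic _)
  · rintro ⟨p, q⟩ ⟨hp, hq, h, -⟩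
    exact (UniqueFactorizationMonoid.dvd_iff_normalizedFactors_le_normalizedFactors hp.ne_zero
      hf).1 ⟨q, h.symm⟩
  · rintro ⟨p, q⟩ ⟨hp, hq, h, -⟩ ⟨p', q'⟩ ⟨hp', hq', h', -⟩ he
    have h1 := UniqueFactorizationMonoid.prod_normalizedFactors hp.ne_zero
    have h2 := UniqueFactorizationMonoid.prod_normalizedFactors hp'.ne_zero
    simp only at he h h'
    rw [he] at h1
    have h3 : p = p' := eq_of_monic_of_associated hp hp' (h1.symm.trans h2)
    subst h3
    have h4 : q = q' := mul_left_cancel₀ hp.ne_zero (h.trans h'.symm)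
    rw [h4]

/-- `t` divides neither of the two factors. -/
def SplitBetween (t : ℝ[X]) (d : ℝ[X] × ℝ[X]) : Prop := ¬ t ∣ d.1 ∧ ¬ t ∣ d.2

theorem not_isRoot_of_isCoprime {p q : ℝ[X]} (h : IsCoprime p q) {a : ℝ} (ha : p.IsRoot a) :
    ¬ q.IsRoot a := by
  obtain ⟨u, v, huv⟩ := h
  intro hb
  have := congrArg (eval a) huv
  simp only [eval_add, eval_mul, ha.eq_zero, hb.eq_zero, eval_one] at this
  simp at this

theorem isCoprime_X_sub_C_of_not_isRoot {q : ℝ[X]} {a : ℝ} (h : ¬ q.IsRoot a) :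
    IsCoprime (X - C a) q :=
  (irreducible_X_sub_C a).coprime_iff_not_dvd.2 fun h' => h (dvd_iff_isRoot.1 h')

/-- Without a real root `t` would be prime and divide one factor. If both roots of `t` belonged to
the same factor, `t` would be coprime to the other and divide that one; this also excludes a double
root. -/
theorem SplitBetween.exists_roots {t p q : ℝ[X]} (ht : t.Monic) (h2 : t.natDegree = 2)
    (hpq : IsCoprime p q) (htd : t ∣ p * q) (h : SplitBetween t (p, q)) :
    ∃ a b : ℝ, t = (X - C a) * (X - C b) ∧ p.IsRoot a ∧ q.IsRoot b := by
  have hroot : ∃ a, t.IsRoot a := by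
    by_contra! hn
    have hi : Irreducible t := by
      rw [ht.irreducible_iff_roots_eq_zero_of_degree_le_three h2.ge (by omega)]
      refine Multiset.eq_zero_of_forall_notMem fun a ha => hn a (isRoot_of_mem_roots ha)
    rcases hi.prime.dvd_or_dvd htd with h' | h'
    exacts [h.1 h', h.2 h']
  obtain ⟨a, ha⟩ := hroot
  obtain ⟨b, rfl⟩ := exists_eq_X_sub_C_mul_X_sub_C ht h2 ha
  have hor : ∀ c, ((X - C a) * (X - C b)).IsRoot c → p.IsRoot c ∨ q.IsRoot c := fun c hc => by
    simpa using (hc.dvd htd)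
  have both : ∀ p q : ℝ[X], IsCoprime p q → (X - C a) * (X - C b) ∣ p * q → p.IsRoot a →
      p.IsRoot b → (X - C a) * (X - C b) ∣ p := fun p q hpq hd ha hb =>
    ((isCoprime_X_sub_C_of_not_isRoot (not_isRoot_of_isCoprime hpq ha)).mul_left
      (isCoprime_X_sub_C_of_not_isRoot (not_isRoot_of_isCoprime hpq hb))).dvd_of_dvd_mul_right hd
  rcases hor a ha with h1 | h1 <;> rcases hor b (by simp) with h3 | h3
  · exact absurd (both p q hpq htd h1 h3) h.1
  · exact ⟨a, b, rfl, h1, h3⟩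
  · exact ⟨b, a, mul_comm _ _, h3, h1⟩
  · exact absurd (both q p hpq.symm (by rwa [mul_comm q p]) h1 h3) h.2

/-- `d'` arises from `d` by exchanging the roots of the first `T i` that is split by `d`. -/
def SwapRelated {N : ℕ} (T : Fin N → ℝ[X]) (d d' : ℝ[X] × ℝ[X]) : Prop :=
  ∃ (i : Fin N) (a b : ℝ) (p q : ℝ[X]), (SplitBetween (T i) d ∧ ∀ j < i, ¬ SplitBetween (T j) d) ∧
    (SplitBetween (T i) d' ∧ ∀ j < i, ¬ SplitBetween (T j) d') ∧
    T i = (X - C a) * (X - C b) ∧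
    d = ((X - C a) * p, (X - C b) * q) ∧ d' = ((X - C b) * p, (X - C a) * q)

theorem SwapRelated.symm {N : ℕ} {T : Fin N → ℝ[X]} {d d' : ℝ[X] × ℝ[X]}
    (h : SwapRelated T d d') : SwapRelated T d' d := by
  obtain ⟨i, a, b, p, q, h1, h2, h3, h4, h5⟩ := h
  exact ⟨i, b, a, p, q, h2, h1, by rw [h3, mul_comm], h5, h4⟩

/-- The index is forced by minimality. The roots are forced because taking them in the other order
would give a common root of the two coprime factors. -/
theorem SwapRelated.unique {N : ℕ} {T : Fin N → ℝ[X]} {d d₁ d₂ : ℝ[X] × ℝ[X]}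
    (hd : IsCoprime d.1 d.2) (h₁ : SwapRelated T d d₁) (h₂ : SwapRelated T d d₂) : d₁ = d₂ := by
  obtain ⟨i, a, b, p, q, ⟨h1, h1'⟩, -, h3, h4, rfl⟩ := h₁
  obtain ⟨i', a', b', p', q', ⟨g1, g1'⟩, -, g3, g4, rfl⟩ := h₂
  have hi : i = i' := le_antisymm (not_lt.1 fun hlt => h1' _ hlt g1) (not_lt.1 fun hlt => g1' _ hlt h1)
  subst hi
  have e : (X - C a) * (X - C b) = (X - C a') * (X - C b') := h3.symm.trans g3
  have ep : (X - C a) * p = (X - C a') * p' := congrArg Prod.fst (h4.symm.trans g4)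
  have eq : (X - C b) * q = (X - C b') * q' := congrArg Prod.snd (h4.symm.trans g4)
  rw [h4] at hd
  simp only at hd
  have ha : a' = a := by
    have h5 : ((X - C a) * (X - C b)).IsRoot a' := by rw [e]; simp
    simp only [IsRoot.def, eval_mul, eval_sub, eval_X, eval_C, mul_eq_zero, sub_eq_zero] at h5
    rcases h5 with h5 | h5
    · exact h5
    · subst h5
      exact absurd (by simp) (not_isRoot_of_isCoprime hd (a := a') (by rw [ep]; simp))
  subst ha
  have e2 := mul_left_cancel₀ (X_sub_C_ne_zero a') e
  have hb : b = b' := by simpa using e2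
  subst hb
  rw [mul_left_cancel₀ (X_sub_C_ne_zero a') ep, mul_left_cancel₀ (X_sub_C_ne_zero b) eq]

/-- A family of monic quadratic polynomials with pairwise nonnegative resultants. -/
structure IsQuadraticSystem {N : ℕ} (T : Fin N → ℝ[X]) : Prop where
  monic : ∀ i, (T i).Monic
  natDegree : ∀ i, (T i).natDegree = 2
  resultant_nonneg : ∀ i j, i ≠ j → 0 ≤ resultant (T i) (T j)

/-! ### Cancellation and counting for a quadratic system -/

section Count

variable {N m : ℕ} {T : Fin N → ℝ[X]}

/-- Neither exchanged root is a root of the product of the other `T j`, so the exchange does not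
affect which of those are split, and the first split index stays the same. -/
theorem exists_swapRelated (hT : IsQuadraticSystem T)
    (hcop : ∀ d ∈ monicFactorPairs (∏ i, T i) m, IsCoprime d.1 d.2) {d : ℝ[X] × ℝ[X]}
    (hd : d ∈ monicFactorPairs (∏ i, T i) m) (hs : ∃ i, SplitBetween (T i) d) :
    ∃ d' ∈ monicFactorPairs (∏ i, T i) m, (∃ i, SplitBetween (T i) d') ∧ SwapRelated T d d' := by
  classical
  obtain ⟨i, hi, hmin⟩ := wellFounded_lt.has_min {i | SplitBetween (T i) d} hs
  have hdc := hcop d hd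
  obtain ⟨P, Q⟩ := d
  obtain ⟨hP, hQ, hPQ, hdeg⟩ := hd
  simp only at hP hQ hPQ hdeg hdc
  obtain ⟨a, b, hab, ha, hb⟩ := hi.exists_roots (hT.monic i) (hT.natDegree i) hdc
    (hPQ ▸ Finset.dvd_prod_of_mem T (Finset.mem_univ i))
  obtain ⟨p, rfl⟩ := dvd_iff_isRoot.2 ha
  obtain ⟨q, rfl⟩ := dvd_iff_isRoot.2 hb
  have hp : p.Monic := (monic_X_sub_C a).of_mul_monic_left hP
  have hq : q.Monic := (monic_X_sub_C b).of_mul_monic_left hQ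
  have hd' : ((X - C b) * p, (X - C a) * q) ∈ monicFactorPairs (∏ i, T i) m := by
    refine ⟨(monic_X_sub_C b).mul hp, (monic_X_sub_C a).mul hq, ?_, ?_⟩
    · rw [← hPQ]; ring
    · rw [← hdeg, (monic_X_sub_C a).natDegree_mul hp, (monic_X_sub_C b).natDegree_mul hp]
      simp
  have hdc' := hcop _ hd'
  simp only at hdc'
  have hg : ∏ j ∈ Finset.univ.erase i, T j = p * q := by
    refine mul_left_cancel₀ (hT.monic i).ne_zero ?_
    rw [Finset.mul_prod_erase _ _ (Finset.mem_univ i), ← hPQ, hab]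
    ring
  -- Coprimality of the original pair excludes `q(a) = 0` and `p(b) = 0`; the other two cases need
  -- coprimality of the swapped pair.
  have hpa : ¬ p.IsRoot a := fun h =>
    not_isRoot_of_isCoprime hdc' (h.dvd (dvd_mul_left _ _)) (by simp)
  have hqa : ¬ q.IsRoot a := fun h =>
    not_isRoot_of_isCoprime hdc (a := a) (by simp) (h.dvd (dvd_mul_left _ _))
  have hpb : ¬ p.IsRoot b := fun h =>
    not_isRoot_of_isCoprime hdc (h.dvd (dvd_mul_left _ _)) (by simp)
  have hqb : ¬ q.IsRoot b := fun h =>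
    not_isRoot_of_isCoprime hdc' (a := b) (by simp) (h.dvd (dvd_mul_left _ _))
  have hcopr : ∀ c, ¬ p.IsRoot c → ¬ q.IsRoot c → ∀ j, j ≠ i → IsCoprime (T j) (X - C c) :=
    fun c hc hc' j hj => by
      refine (isCoprime_X_sub_C_of_not_isRoot fun h => ?_).symm
      have := h.dvd (hg ▸ Finset.dvd_prod_of_mem T (by simpa using hj))
      rcases (by simpa using this : p.IsRoot c ∨ q.IsRoot c) with h | h
      exacts [hc h, hc' h]
  have hiff : ∀ j, j ≠ i → (SplitBetween (T j) ((X - C b) * p, (X - C a) * q) ↔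
      SplitBetween (T j) ((X - C a) * p, (X - C b) * q)) := fun j hj => by
    have h1 := hcopr a hpa hqa j hj
    have h2 := hcopr b hpb hqb j hj
    have e : ∀ {c : ℝ} (r : ℝ[X]), IsCoprime (T j) (X - C c) →
        (T j ∣ (X - C c) * r ↔ T j ∣ r) := fun r hc =>
      ⟨hc.dvd_of_dvd_mul_left, fun h => h.mul_left _⟩
    simp only [SplitBetween, e _ h1, e _ h2]
  have hi' : SplitBetween (T i) ((X - C b) * p, (X - C a) * q) := by
    refine ⟨fun h => ?_, fun h => ?_⟩
    · exact not_isRoot_of_isCoprime hdc' (IsRoot.dvd (x := a) (by rw [hab]; simp) h) (by simp)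
    · exact not_isRoot_of_isCoprime hdc' (a := b) (by simp)
        (IsRoot.dvd (x := b) (by rw [hab]; simp) h)
  refine ⟨_, hd', ⟨i, hi'⟩, i, a, b, p, q, ⟨hi, fun j hj h => hmin j h hj⟩,
    ⟨hi', fun j hj h => hmin j ((hiff j hj.ne).1 h) hj⟩, hab, rfl, rfl⟩

/-- The values of the cofactor `∏ T j`, `j ≠ i`, at the two roots of `T i` multiply to `∏ Res (T i,
T j) ≥ 0`, which is what the sign reversal under exchange requires. -/
theorem SwapRelated.sign_add_sign (hT : IsQuadraticSystem T)
    (hcop : ∀ d ∈ monicFactorPairs (∏ i, T i) m, IsCoprime d.1 d.2) {d d' : ℝ[X] × ℝ[X]}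
    (hd : d ∈ monicFactorPairs (∏ i, T i) m) (hd' : d' ∈ monicFactorPairs (∏ i, T i) m)
    (h : SwapRelated T d d') :
    (SignType.sign (resultant d.1 d.2) : ℤ) + SignType.sign (resultant d'.1 d'.2) = 0 := by
  classical
  have h1 := resultant_ne_zero _ _ (hcop d hd)
  have h2 := resultant_ne_zero _ _ (hcop d' hd')
  obtain ⟨i, a, b, p, q, -, -, hab, rfl, rfl⟩ := h
  obtain ⟨hP, hQ, hPQ, -⟩ := hd
  simp only at h1 h2 hP hQ hPQ ⊢
  have hg : ∏ j ∈ Finset.univ.erase i, T j = p * q := by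
    refine mul_left_cancel₀ (hT.monic i).ne_zero ?_
    rw [Finset.mul_prod_erase _ _ (Finset.mem_univ i), ← hPQ, hab]
    ring
  have h3 := resultant_mul_resultant_swap_nonpos (a := a) (b := b)
    ((monic_X_sub_C a).of_mul_monic_left hP) ((monic_X_sub_C b).of_mul_monic_left hQ) (by
      rw [← hg, eval_prod, eval_prod, ← Finset.prod_mul_distrib]
      refine Finset.prod_nonneg fun j hj => ?_
      rw [← resultant_X_sub_C_mul_X_sub_C, ← hab]
      exact hT.resultant_nonneg i j (Finset.ne_of_mem_erase hj).symm)
  rcases h1.lt_or_gt with h1 | h1 <;> rcases h2.lt_or_gt with h2 | h2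
  · exact absurd h3 (mul_pos_of_neg_of_neg h1 h2).not_ge
  · simp [sign_neg h1, sign_pos h2]
  · simp [sign_pos h1, sign_neg h2]
  · exact absurd h3 (mul_pos h1 h2).not_ge

theorem natDegree_prod_quadratic (hT : IsQuadraticSystem T) (I : Finset (Fin N)) :
    (∏ i ∈ I, T i).natDegree = 2 * I.card := by
  rw [natDegree_prod_of_monic _ _ fun i _ => hT.monic i]
  simp [hT.natDegree, mul_comm]

theorem prod_mem_monicFactorPairs (hT : IsQuadraticSystem T) (I : Finset (Fin N)) :
    (∏ i ∈ I, T i, ∏ i ∈ Iᶜ, T i) ∈ monicFactorPairs (∏ i, T i) (2 * I.card) :=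
  ⟨monic_prod_of_monic _ _ fun i _ => hT.monic i, monic_prod_of_monic _ _ fun i _ => hT.monic i,
    Finset.prod_mul_prod_compl I T, natDegree_prod_quadratic hT I⟩

/-- The resultant is the product of the nonnegative `Res (T i, T j)` with `i ∈ I`, `j ∉ I`, and
coprimality excludes zero. -/
theorem sign_resultant_prod (hT : IsQuadraticSystem T) (I : Finset (Fin N))
    (hcop : IsCoprime (∏ i ∈ I, T i) (∏ i ∈ Iᶜ, T i)) :
    SignType.sign (resultant (∏ i ∈ I, T i) (∏ i ∈ Iᶜ, T i)) = 1 := by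
  have h0 := resultant_ne_zero _ _ hcop
  refine sign_pos (lt_of_le_of_ne ?_ h0.symm)
  rw [resultant_prod_left _ _ _ _ (by simp [(hT.monic _).leadingCoeff]) le_rfl]
  refine Finset.prod_nonneg fun i hi => ?_
  rw [resultant_prod_right _ _ _ _ le_rfl (by simp [(hT.monic _).leadingCoeff])]
  refine Finset.prod_nonneg fun j hj => hT.resultant_nonneg i j ?_
  rintro rfl
  exact (Finset.mem_compl.1 hj) hi

theorem not_splitBetween_prod (I : Finset (Fin N)) (i : Fin N) :
    ¬ SplitBetween (T i) (∏ i ∈ I, T i, ∏ i ∈ Iᶜ, T i) := fun h => by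
  by_cases hi : i ∈ I
  · exact h.1 (Finset.dvd_prod_of_mem T hi)
  · exact h.2 (Finset.dvd_prod_of_mem T (Finset.mem_compl.2 hi))

/-- Take for `I` the indices with `T i ∣ P`. Coprimality gives `P ∣ ∏ I` and `Q ∣ ∏ Iᶜ`, and
comparing degrees turns both into equalities. -/
theorem exists_eq_prod_of_not_splitBetween (hT : IsQuadraticSystem T) {d : ℝ[X] × ℝ[X]}
    (hd : d ∈ monicFactorPairs (∏ i, T i) m) (hdc : IsCoprime d.1 d.2)
    (hs : ∀ i, ¬ SplitBetween (T i) d) :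
    ∃ I : Finset (Fin N), d = (∏ i ∈ I, T i, ∏ i ∈ Iᶜ, T i) := by
  classical
  obtain ⟨P, Q⟩ := d
  obtain ⟨hP, hQ, hPQ, -⟩ := hd
  simp only at hP hQ hPQ hdc
  set I := Finset.univ.filter fun i => T i ∣ P
  have hQI : ∀ i ∈ Iᶜ, T i ∣ Q := fun i hi => by
    by_contra h
    exact hs i ⟨fun h' => by simp [I, h'] at hi, h⟩
  have h1 : P ∣ ∏ i ∈ I, T i := by
    have : P ∣ (∏ i ∈ I, T i) * ∏ i ∈ Iᶜ, T i := by
      rw [Finset.prod_mul_prod_compl, ← hPQ]; exact dvd_mul_right _ _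
    refine IsCoprime.dvd_of_dvd_mul_right (IsCoprime.prod_right fun i hi => ?_) this
    exact hdc.of_isCoprime_of_dvd_right (hQI i hi)
  have h2 : Q ∣ ∏ i ∈ Iᶜ, T i := by
    have : Q ∣ (∏ i ∈ I, T i) * ∏ i ∈ Iᶜ, T i := by
      rw [Finset.prod_mul_prod_compl, ← hPQ]; exact dvd_mul_left _ _
    refine IsCoprime.dvd_of_dvd_mul_left (IsCoprime.prod_right fun i hi => ?_) this
    exact hdc.symm.of_isCoprime_of_dvd_right (Finset.mem_filter.1 hi).2
  have hI := monic_prod_of_monic I T fun i _ => hT.monic i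
  have hI' := monic_prod_of_monic Iᶜ T fun i _ => hT.monic i
  have hdeg : P.natDegree + Q.natDegree =
      (∏ i ∈ I, T i).natDegree + (∏ i ∈ Iᶜ, T i).natDegree := by
    rw [← hP.natDegree_mul hQ, ← hI.natDegree_mul hI', hPQ, Finset.prod_mul_prod_compl]
  have h3 := natDegree_le_of_dvd h1 hI.ne_zero
  have h4 := natDegree_le_of_dvd h2 hI'.ne_zero
  refine ⟨I, ?_⟩
  rw [eq_of_monic_of_dvd_of_natDegree_le hP hI h1 (by omega),
    eq_of_monic_of_dvd_of_natDegree_le hQ hI' h2 (by omega)]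

/-- Distinct indices may carry equal quadratics, so coprimality is needed: `T j` with `j ∈ J \ I`
would divide both complementary products. -/
theorem prod_injective_of_isCoprime (hT : IsQuadraticSystem T) {I J : Finset (Fin N)}
    (hcard : I.card = J.card) (hcop : IsCoprime (∏ i ∈ I, T i) (∏ i ∈ Iᶜ, T i))
    (h : ∏ i ∈ I, T i = ∏ i ∈ J, T i) : I = J := by
  by_contra hne
  have hJI : ¬ J ⊆ I := fun hJI => hne (Finset.eq_of_subset_of_card_le hJI hcard.le).symm
  obtain ⟨j, hj, hj'⟩ := Finset.not_subset.1 hJI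
  have h1 : T j ∣ ∏ i ∈ I, T i := h ▸ Finset.dvd_prod_of_mem T hj
  have h2 : T j ∣ ∏ i ∈ Iᶜ, T i := Finset.dvd_prod_of_mem T (Finset.mem_compl.2 hj')
  have h3 := natDegree_eq_zero_of_isUnit (hcop.isUnit_of_dvd' h1 h2)
  rw [hT.natDegree] at h3
  omega

theorem sum_sign_resultant_split (hT : IsQuadraticSystem T)
    (hcop : ∀ d ∈ monicFactorPairs (∏ i, T i) m, IsCoprime d.1 d.2)
    (s : Finset (ℝ[X] × ℝ[X]))
    (hs : ∀ d, d ∈ s ↔ d ∈ monicFactorPairs (∏ i, T i) m ∧ ∃ i, SplitBetween (T i) d) :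
    ∑ d ∈ s, (SignType.sign (resultant d.1 d.2) : ℤ) = 0 := by
  refine sum_eq_zero_of_cancelling_relation s _ (SwapRelated T) ?_ ?_ ?_ ?_
  · intro d hd
    obtain ⟨hd, hds⟩ := (hs d).1 hd
    obtain ⟨d', hd', hs', hR⟩ := exists_swapRelated hT hcop hd hds
    exact ⟨d', (hs d').2 ⟨hd', hs'⟩, hR⟩
  · exact fun _ _ => SwapRelated.symm
  · exact fun d hd d₁ d₂ h₁ h₂ => h₁.unique (hcop d ((hs d).1 hd).1) h₂
  · exact fun d hd d' hd' h => h.sign_add_sign hT hcop ((hs d).1 hd).1 ((hs d').1 hd').1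

theorem sum_sign_resultant_nonsplit {k : ℕ} (hT : IsQuadraticSystem T)
    (hcop : ∀ d ∈ monicFactorPairs (∏ i, T i) (2 * k), IsCoprime d.1 d.2)
    (s : Finset (ℝ[X] × ℝ[X]))
    (hs : ∀ d, d ∈ s ↔ d ∈ monicFactorPairs (∏ i, T i) (2 * k) ∧ ¬ ∃ i, SplitBetween (T i) d) :
    ∑ d ∈ s, (SignType.sign (resultant d.1 d.2) : ℤ) = (N.choose k : ℤ) := by
  classical
  have hmem : ∀ I ∈ Finset.powersetCard k (Finset.univ : Finset (Fin N)),
      (∏ i ∈ I, T i, ∏ i ∈ Iᶜ, T i) ∈ monicFactorPairs (∏ i, T i) (2 * k) := fun I hI => by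
    have := prod_mem_monicFactorPairs hT I
    rwa [(Finset.mem_powersetCard.1 hI).2] at this
  have hmem' : ∀ I ∈ Finset.powersetCard k (Finset.univ : Finset (Fin N)),
      IsCoprime (∏ i ∈ I, T i) (∏ i ∈ Iᶜ, T i) := fun I hI =>
    hcop (∏ i ∈ I, T i, ∏ i ∈ Iᶜ, T i) (hmem I hI)
  have : s = (Finset.powersetCard k (Finset.univ : Finset (Fin N))).image
      fun I => (∏ i ∈ I, T i, ∏ i ∈ Iᶜ, T i) := by
    ext d
    rw [hs, Finset.mem_image]
    constructor
    · rintro ⟨hd, hds⟩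
      obtain ⟨I, hI⟩ := exists_eq_prod_of_not_splitBetween hT hd (hcop d hd) (not_exists.1 hds)
      refine ⟨I, ?_, hI.symm⟩
      have h1 := hd.2.2.2
      rw [hI, natDegree_prod_quadratic hT] at h1
      exact Finset.mem_powersetCard.2 ⟨Finset.subset_univ _, by omega⟩
    · rintro ⟨I, hI, rfl⟩
      exact ⟨hmem I hI, fun ⟨i, hi⟩ => not_splitBetween_prod I i hi⟩
  rw [this, Finset.sum_image]
  · have h1 : ∀ I ∈ Finset.powersetCard k (Finset.univ : Finset (Fin N)),
        (SignType.sign (resultant (∏ i ∈ I, T i) (∏ i ∈ Iᶜ, T i)) : ℤ) = 1 := fun I hI => by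
      rw [sign_resultant_prod hT I (hmem' I hI), SignType.coe_one]
    refine (Finset.sum_congr rfl h1).trans ?_
    rw [Finset.sum_const, Finset.card_powersetCard, Finset.card_univ, Fintype.card_fin,
      nsmul_eq_mul, mul_one]
  · intro I hI J hJ h
    exact prod_injective_of_isCoprime hT
      ((Finset.mem_powersetCard.1 hI).2.trans (Finset.mem_powersetCard.1 hJ).2.symm)
      (hmem' I hI) (congrArg Prod.fst h)

end Count

/-- If all monic factorizations of a monic real polynomial of degree `2 * (k + l)` into factors of
degrees `2 * k` and `2 * l` are coprime, their number, counted with the sign of the resultant, is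
`(k + l).choose k`. -/
theorem sum_sign_resultant_monicFactorPairs (k l : ℕ) {f : ℝ[X]} (hf : f.Monic)
    (hdeg : f.natDegree = 2 * (k + l))
    (hcop : ∀ d ∈ monicFactorPairs f (2 * k), IsCoprime d.1 d.2) :
    ∑ᶠ d ∈ monicFactorPairs f (2 * k), (SignType.sign (resultant d.1 d.2) : ℤ) =
      ((k + l).choose k : ℤ) := by
  classical
  have hfin := finite_monicFactorPairs hf.ne_zero (2 * k)
  obtain ⟨T, hT1, hT2, rfl, hT3⟩ := exists_prod_quadratic_eq (k + l) hf hdeg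
  have hT : IsQuadraticSystem T := ⟨hT1, hT2, hT3⟩
  rw [finsum_mem_eq_finite_toFinset_sum _ hfin,
    ← Finset.sum_filter_add_sum_filter_not _ fun d => ∃ i, SplitBetween (T i) d,
    sum_sign_resultant_split hT hcop _ fun d => by rw [Finset.mem_filter, hfin.mem_toFinset],
    sum_sign_resultant_nonsplit hT hcop _ fun d => by rw [Finset.mem_filter, hfin.mem_toFinset],
    zero_add]

/-! ## Multiplication of polynomials in coefficients -/

/-- Coefficient vectors to polynomials, as a linear map. -/
def polyOfCoeffsₗ (m : ℕ) : EuclideanSpace ℝ (Fin (m + 1)) →ₗ[ℝ] ℝ[X] where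
  toFun := polyOfCoeffs
  map_add' a b := by simp [polyOfCoeffs, Finset.sum_add_distrib]
  map_smul' c a := by
    simp only [polyOfCoeffs, PiLp.smul_apply, smul_eq_mul, RingHom.id_apply, Finset.smul_sum,
      smul_monomial]

@[simp]
theorem polyOfCoeffsₗ_apply {m : ℕ} (a : EuclideanSpace ℝ (Fin (m + 1))) :
    polyOfCoeffsₗ m a = polyOfCoeffs a := rfl

theorem polyOfCoeffs_smul {m : ℕ} (c : ℝ) (a : EuclideanSpace ℝ (Fin (m + 1))) :
    polyOfCoeffs (c • a) = C c * polyOfCoeffs a := by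
  rw [← smul_eq_C_mul]
  exact (polyOfCoeffsₗ m).map_smul c a

theorem polyOfCoeffs_injective {m : ℕ} :
    Function.Injective (polyOfCoeffs : EuclideanSpace ℝ (Fin (m + 1)) → ℝ[X]) := fun a b h => by
  ext i
  rw [← polyOfCoeffs_coeff a, ← polyOfCoeffs_coeff b, h]

theorem polyOfCoeffs_toLp_coeff {m : ℕ} {p : ℝ[X]} (hp : p.natDegree ≤ m) :
    polyOfCoeffs (WithLp.toLp 2 fun i : Fin (m + 1) => p.coeff i) = p := by
  simp only [polyOfCoeffs]
  rw [Fin.sum_univ_eq_sum_range (fun i => monomial i (p.coeff i)) (m + 1)]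
  exact (p.as_sum_range' (m + 1) (by omega)).symm

theorem polyOfCoeffs_polyMul {m n : ℕ} (a : EuclideanSpace ℝ (Fin (m + 1)))
    (b : EuclideanSpace ℝ (Fin (n + 1))) :
    polyOfCoeffs (polyMul a b) = polyOfCoeffs a * polyOfCoeffs b :=
  polyOfCoeffs_toLp_coeff (natDegree_mul_le.trans
    (add_le_add (polyOfCoeffs_natDegree_le a) (polyOfCoeffs_natDegree_le b)))

/-- Multiplication of polynomials in coefficients, as a bilinear map. -/
def polyMulₗ (m n : ℕ) : EuclideanSpace ℝ (Fin (m + 1)) →ₗ[ℝ] EuclideanSpace ℝ (Fin (n + 1)) →ₗ[ℝ]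
    EuclideanSpace ℝ (Fin (m + n + 1)) :=
  LinearMap.mk₂ ℝ polyMul
    (fun a a' b => polyOfCoeffs_injective <| by
      have h := fun d => (polyOfCoeffsₗ d).map_add
      simp only [polyOfCoeffsₗ_apply] at h
      simp only [h, polyOfCoeffs_polyMul, add_mul])
    (fun c a b => polyOfCoeffs_injective <| by
      simp only [polyOfCoeffs_smul, polyOfCoeffs_polyMul, mul_assoc])
    (fun a b b' => polyOfCoeffs_injective <| by
      have h := fun d => (polyOfCoeffsₗ d).map_add
      simp only [polyOfCoeffsₗ_apply] at h
      simp only [h, polyOfCoeffs_polyMul, mul_add])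
    (fun c a b => polyOfCoeffs_injective <| by
      simp only [polyOfCoeffs_smul, polyOfCoeffs_polyMul, mul_left_comm])

@[simp]
theorem polyMulₗ_apply {m n : ℕ} (a : EuclideanSpace ℝ (Fin (m + 1)))
    (b : EuclideanSpace ℝ (Fin (n + 1))) : polyMulₗ m n a b = polyMul a b := rfl

/-! ## The determinant of products of frames -/

theorem basisFun_det_eq {d : ℕ} (v : Fin d → EuclideanSpace ℝ (Fin d)) :
    (EuclideanSpace.basisFun (Fin d) ℝ).toBasis.det v = (Matrix.of fun i j => v j i).det := by
  rw [Module.Basis.det_apply]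
  congr 1

/-- The order of the columns `(x * y, aᵢ * y, x * bⱼ)` compared with `(aᵢ * y), (x * y, x * bⱼ)`. -/
def frameColumns (m n : ℕ) : Fin (m + n + 1) ≃ Fin m ⊕ Fin (n + 1) :=
  Equiv.ofBijective (Fin.cons (Sum.inr 0) (Fin.append Sum.inl fun j => Sum.inr j.succ) :
    Fin (m + n + 1) → Fin m ⊕ Fin (n + 1)) <| by
    rw [Fintype.bijective_iff_surjective_and_card]
    refine ⟨?_, by simp; omega⟩
    rintro (i | j)
    · exact ⟨(Fin.castAdd n i).succ, by simp⟩
    · cases j using Fin.cases with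
      | zero => exact ⟨0, by simp⟩
      | succ j => exact ⟨(Fin.natAdd m j).succ, by simp⟩

/-- The identification of `Fin m ⊕ Fin (n + 1)` with `Fin (m + n + 1)`. -/
def sumSuccEquiv (m n : ℕ) : Fin m ⊕ Fin (n + 1) ≃ Fin (m + n + 1) := finSumFinEquiv

/-- The columns `X ^ i * y`, `i < m`, and `X ^ j * x`, `j ≤ n`. -/
def extendedSylvester {m n : ℕ} (x : EuclideanSpace ℝ (Fin (m + 1)))
    (y : EuclideanSpace ℝ (Fin (n + 1))) : Matrix (Fin (m + n + 1)) (Fin m ⊕ Fin (n + 1)) ℝ :=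
  Matrix.of fun r => Sum.elim (fun i => (polyOfCoeffs y * X ^ (i : ℕ)).coeff r)
    (fun j => (polyOfCoeffs x * X ^ (j : ℕ)).coeff r)

/-- The row of degree `m + n` has only one possibly nonzero entry, the top coefficient of `x` in the
column `X ^ n * x`; the complementary minor is the Sylvester matrix. -/
theorem det_extendedSylvester {m n : ℕ} (x : EuclideanSpace ℝ (Fin (m + 1)))
    (y : EuclideanSpace ℝ (Fin (n + 1))) :
    ((extendedSylvester x y).submatrix id (sumSuccEquiv m n).symm).det =
      x (Fin.last m) * resultant (polyOfCoeffs x) (polyOfCoeffs y) m n := by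
  have hx := polyOfCoeffs_natDegree_le x
  have hy := polyOfCoeffs_natDegree_le y
  have hl : (sumSuccEquiv m n).symm (Fin.last (m + n)) =
      (Sum.inr (Fin.last n) : Fin m ⊕ Fin (n + 1)) := by
    rw [Equiv.symm_apply_eq]; rfl
  have hinl : ∀ i : Fin m, (sumSuccEquiv m n).symm (Fin.castSucc (Fin.castAdd n i)) =
      (Sum.inl i : Fin m ⊕ Fin (n + 1)) := fun i => by
    rw [Equiv.symm_apply_eq]; rfl
  have hinr : ∀ j : Fin n, (sumSuccEquiv m n).symm (Fin.castSucc (Fin.natAdd m j)) =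
      (Sum.inr j.castSucc : Fin m ⊕ Fin (n + 1)) := fun j => by
    rw [Equiv.symm_apply_eq]; rfl
  rw [Matrix.det_succ_row _ (Fin.last (m + n)), Finset.sum_eq_single (Fin.last (m + n))]
  · have h1 : ((-1 : ℝ) ^ ((Fin.last (m + n) : ℕ) + (Fin.last (m + n) : ℕ))) = 1 := by
      rw [← two_mul, pow_mul]; simp
    rw [h1, one_mul, resultant]
    congr 1
    · simp only [Matrix.submatrix_apply, hl, extendedSylvester, Matrix.of_apply, Sum.elim_inr, id,
        coeff_mul_X_pow', Fin.val_last]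
      rw [if_pos (by omega), Nat.add_sub_cancel]
      exact polyOfCoeffs_coeff x (Fin.last m)
    · congr 1
      ext i j
      simp only [Matrix.submatrix_apply, Fin.succAbove_last, id, sylvester, Matrix.of_apply]
      induction j using Fin.addCases with
      | left j =>
        rw [hinl, Fin.addCases_left]
        simp only [extendedSylvester, Matrix.of_apply, Sum.elim_inl, coeff_mul_X_pow',
          Fin.val_castSucc, Set.mem_Icc]
        rw [ite_and]
        split_ifs with h1 h2 <;> try rfl
        exact coeff_eq_zero_of_natDegree_lt (by omega)
      | right j =>
        rw [hinr, Fin.addCases_right]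
        simp only [extendedSylvester, Matrix.of_apply, Sum.elim_inr, coeff_mul_X_pow',
          Fin.val_castSucc, Set.mem_Icc]
        rw [ite_and]
        split_ifs with h1 h2 <;> try rfl
        exact coeff_eq_zero_of_natDegree_lt (by omega)
  · intro j _ hj
    obtain ⟨j, rfl⟩ := Fin.exists_castSucc_eq.2 hj
    have : (extendedSylvester x y).submatrix id (sumSuccEquiv m n).symm (Fin.last (m + n))
        j.castSucc = 0 := by
      induction j using Fin.addCases with
      | left j =>
        simp only [Matrix.submatrix_apply, hinl, extendedSylvester, Matrix.of_apply, Sum.elim_inl,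
          coeff_mul_X_pow', id, Fin.val_last]
        rw [if_pos (by omega)]
        exact coeff_eq_zero_of_natDegree_lt (by omega)
      | right j =>
        simp only [Matrix.submatrix_apply, hinr, extendedSylvester, Matrix.of_apply, Sum.elim_inr,
          coeff_mul_X_pow', id, Fin.val_last, Fin.val_castSucc]
        rw [if_pos (by omega)]
        exact coeff_eq_zero_of_natDegree_lt (by omega)
    rw [this, mul_zero, zero_mul]
  · simp

/-- Elimination of the last coordinate. -/
theorem det_cons_eq_of_last_ne_zero {m : ℕ} {x : EuclideanSpace ℝ (Fin (m + 1))}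
    (hx : x (Fin.last m) ≠ 0) (a : Fin m → EuclideanSpace ℝ (Fin (m + 1))) :
    (Matrix.of fun i j => (Fin.cons x a : Fin (m + 1) → EuclideanSpace ℝ (Fin (m + 1))) j i).det =
      (-1) ^ m * x (Fin.last m) * (Matrix.of fun (i j : Fin m) =>
        (a j - (a j (Fin.last m) / x (Fin.last m)) • x) i.castSucc).det := by
  have key : (Matrix.of fun i j =>
      (Fin.cons x a : Fin (m + 1) → EuclideanSpace ℝ (Fin (m + 1))) j i).det =
      (Matrix.of fun i j => (Fin.cons x fun j => a j - (a j (Fin.last m) / x (Fin.last m)) • x :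
        Fin (m + 1) → EuclideanSpace ℝ (Fin (m + 1))) j i).det := by
    rw [← Matrix.det_transpose, ← Matrix.det_transpose (Matrix.of _)]
    refine Matrix.det_eq_of_forall_row_eq_smul_add_const
      (Fin.cons 0 fun j => a j (Fin.last m) / x (Fin.last m)) 0 rfl fun j i => ?_
    cases j using Fin.cases <;> simp
  rw [key]
  rw [Matrix.det_succ_row _ (Fin.last m), Finset.sum_eq_single 0]
  · simp only [Fin.val_last, Fin.val_zero, add_zero, Matrix.of_apply, Fin.cons_zero]
    congr 2
    ext i j
    simp [Fin.succAbove_last]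
  · intro j _ hj
    obtain ⟨j, rfl⟩ := Fin.exists_succ_eq.2 hj
    have : (Matrix.of fun i j =>
      (Fin.cons x fun j => a j - (a j (Fin.last m) / x (Fin.last m)) • x :
        Fin (m + 1) → EuclideanSpace ℝ (Fin (m + 1))) j i) (Fin.last m) j.succ = 0 := by
      simp [hx]
    rw [this, mul_zero, zero_mul]
  · simp

/-- The frame `(x * y, aᵢ * y, x * bⱼ)`. -/
def productFrame {m n : ℕ} (x : EuclideanSpace ℝ (Fin (m + 1))) (y : EuclideanSpace ℝ (Fin (n + 1)))
    (a : Fin m → EuclideanSpace ℝ (Fin (m + 1))) (b : Fin n → EuclideanSpace ℝ (Fin (n + 1))) :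
    Fin (m + n + 1) → EuclideanSpace ℝ (Fin (m + n + 1)) :=
  Fin.cons (polyMul x y) (Fin.append (fun i => polyMul (a i) y) (fun j => polyMul x (b j)))

/-- The sign relating the determinant of a product frame to the resultant. -/
def productFrameSign (m n : ℕ) : ℤ :=
  (Equiv.Perm.sign ((frameColumns m n).trans (sumSuccEquiv m n)) : ℤ) * (-1) ^ m

theorem productFrameSign_eq (m n : ℕ) : productFrameSign m n = 1 ∨ productFrameSign m n = -1 := by
  rw [productFrameSign]
  rcases Int.units_eq_one_or (Equiv.Perm.sign ((frameColumns m n).trans (sumSuccEquiv m n)))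
    with h | h <;> rcases neg_one_pow_eq_or ℤ m with h' | h' <;> simp [h, h']

theorem polyOfCoeffs_eq_sum {d : ℕ} (v : EuclideanSpace ℝ (Fin (d + 1))) :
    polyOfCoeffs v = ∑ i, C (v i) * X ^ (i : ℕ) := by
  simp only [polyOfCoeffs, C_mul_X_pow_eq_monomial]

/-- Subtracting `c j • x` from `a j` removes its top coefficient, so `a j * y` is a combination of
the `X ^ i * y`, `i < m`, plus `c j * y * x`. Hence the frame is the extended Sylvester matrix times
the block triangular `K`. The top coefficient of `x` in the first determinant is absorbed by `det
(x, a)`. -/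
theorem det_productFrame_of_last_ne_zero {m n : ℕ} {x : EuclideanSpace ℝ (Fin (m + 1))}
    (hx : x (Fin.last m) ≠ 0) (y : EuclideanSpace ℝ (Fin (n + 1)))
    (a : Fin m → EuclideanSpace ℝ (Fin (m + 1))) (b : Fin n → EuclideanSpace ℝ (Fin (n + 1))) :
    (EuclideanSpace.basisFun _ ℝ).toBasis.det (productFrame x y a b) =
      productFrameSign m n * (EuclideanSpace.basisFun _ ℝ).toBasis.det (Fin.cons x a) *
        (EuclideanSpace.basisFun _ ℝ).toBasis.det (Fin.cons y b) *
        resultant (polyOfCoeffs x) (polyOfCoeffs y) m n := by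
  set c : Fin m → ℝ := fun j => a j (Fin.last m) / x (Fin.last m)
  set B : Fin (n + 1) → EuclideanSpace ℝ (Fin (n + 1)) := Fin.cons y b
  set K₁ : Matrix (Fin m) (Fin m) ℝ := Matrix.of fun i j => (a j - c j • x) i.castSucc
  set K : Matrix (Fin m ⊕ Fin (n + 1)) (Fin m ⊕ Fin (n + 1)) ℝ :=
    Matrix.fromBlocks K₁ 0 (Matrix.of fun i j => c j * y i) (Matrix.of fun i j => B j i)
  have hM : (Matrix.of fun r j => productFrame x y a b j r) =
      (extendedSylvester x y * K).submatrix id (frameColumns m n) := by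
    have hcoeff : ∀ (u : EuclideanSpace ℝ (Fin (m + 1))) (v : EuclideanSpace ℝ (Fin (n + 1)))
        (r : Fin (m + n + 1)), polyMul u v r = (polyOfCoeffs u * polyOfCoeffs v).coeff r :=
      fun u v r => rfl
    have hinr : ∀ r (j : Fin (n + 1)), (extendedSylvester x y * K) r (Sum.inr j) =
        polyMul x (B j) r := fun r j => by
      simp only [Matrix.mul_apply, Fintype.sum_sum_type, K, Matrix.fromBlocks_apply₁₂,
        Matrix.fromBlocks_apply₂₂, Matrix.zero_apply, mul_zero, Finset.sum_const_zero, zero_add,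
        extendedSylvester, Matrix.of_apply, Sum.elim_inr]
      rw [hcoeff, polyOfCoeffs_eq_sum (B j), Finset.mul_sum, finsetSum_coeff]
      refine Finset.sum_congr rfl fun i _ => ?_
      rw [mul_left_comm, coeff_C_mul, mul_comm]
    have hinl : ∀ r (j : Fin m), (extendedSylvester x y * K) r (Sum.inl j) =
        polyMul (a j) y r := fun r j => by
      simp only [Matrix.mul_apply, Fintype.sum_sum_type, K, Matrix.fromBlocks_apply₁₁,
        Matrix.fromBlocks_apply₂₁, extendedSylvester, Matrix.of_apply, Sum.elim_inr, Sum.elim_inl]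
      have h1 : polyOfCoeffs (a j) = ∑ i : Fin m, C ((a j - c j • x) i.castSucc) * X ^ (i : ℕ) +
          C (c j) * polyOfCoeffs x := by
        have h2 : polyOfCoeffs (a j) = polyOfCoeffs (a j - c j • x) + C (c j) * polyOfCoeffs x := by
          rw [← polyOfCoeffs_smul]
          have := (polyOfCoeffsₗ m).map_add (a j - c j • x) (c j • x)
          rwa [sub_add_cancel] at this
        rw [h2, polyOfCoeffs_eq_sum (a j - c j • x), Fin.sum_univ_castSucc]
        simp [c, hx]
      rw [hcoeff, h1, add_mul, coeff_add, Finset.sum_mul, finsetSum_coeff]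
      congr 1
      · refine Finset.sum_congr rfl fun i _ => ?_
        rw [mul_assoc, coeff_C_mul, mul_comm, mul_comm (X ^ _)]
        rfl
      · rw [polyOfCoeffs_eq_sum y, Finset.mul_sum, finsetSum_coeff]
        refine Finset.sum_congr rfl fun i _ => ?_
        rw [show C (c j) * polyOfCoeffs x * (C (y i) * X ^ (i : ℕ)) =
          C (c j * y i) * (polyOfCoeffs x * X ^ (i : ℕ)) by rw [C_mul]; ring, coeff_C_mul, mul_comm]
    ext r j
    simp only [Matrix.of_apply, Matrix.submatrix_apply, id, frameColumns, Equiv.ofBijective_apply,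
      productFrame]
    cases j using Fin.cases with
    | zero => simp [hinr, B]
    | succ j =>
      induction j using Fin.addCases with
      | left j => simp [hinl]
      | right j => simp [hinr, B]
  have hS : ((extendedSylvester x y).submatrix id (frameColumns m n)) =
      ((extendedSylvester x y).submatrix id (sumSuccEquiv m n).symm).submatrix id
        ((frameColumns m n).trans (sumSuccEquiv m n)) := by
    ext i j; simp
  rw [basisFun_det_eq, basisFun_det_eq, basisFun_det_eq, hM,
    ← Matrix.submatrix_mul_equiv _ _ _ (frameColumns m n), Matrix.det_mul,
    Matrix.det_submatrix_equiv_self, hS, Matrix.det_permute', det_extendedSylvester,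
    Matrix.det_fromBlocks_zero₁₂, det_cons_eq_of_last_ne_zero hx, productFrameSign]
  have h1 : ((-1 : ℝ) ^ m) * (-1) ^ m = 1 := by rw [← mul_pow]; simp
  push_cast
  linear_combination (-(Equiv.Perm.sign ((frameColumns m n).trans (sumSuccEquiv m n)) : ℝ) *
    x (Fin.last m) * K₁.det * (Matrix.of fun i j => B j i).det *
    resultant (polyOfCoeffs x) (polyOfCoeffs y) m n) * h1

theorem continuous_polyOfCoeffs_coeff (m k : ℕ) :
    Continuous fun x : EuclideanSpace ℝ (Fin (m + 1)) => (polyOfCoeffs x).coeff k :=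
  ((lcoeff ℝ k).comp (polyOfCoeffsₗ m)).continuous_of_finiteDimensional

theorem continuous_polyMul_left {m n : ℕ} (y : EuclideanSpace ℝ (Fin (n + 1))) :
    Continuous fun x : EuclideanSpace ℝ (Fin (m + 1)) => polyMul x y :=
  ((polyMulₗ m n).flip y).continuous_of_finiteDimensional

theorem continuous_basisFun_det {d : ℕ} :
    Continuous fun v : Fin d → EuclideanSpace ℝ (Fin d) =>
      (EuclideanSpace.basisFun (Fin d) ℝ).toBasis.det v := by
  simp only [basisFun_det_eq]
  refine Continuous.matrix_det (continuous_matrix fun i j => ?_)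
  simp only [Matrix.of_apply]
  fun_prop

/-- Both sides are continuous in `x`, because the resultant is taken with fixed formal degrees, and
they agree on the dense set where the top coefficient is nonzero. -/
theorem det_productFrame {m n : ℕ} (x : EuclideanSpace ℝ (Fin (m + 1)))
    (y : EuclideanSpace ℝ (Fin (n + 1)))
    (a : Fin m → EuclideanSpace ℝ (Fin (m + 1))) (b : Fin n → EuclideanSpace ℝ (Fin (n + 1))) :
    (EuclideanSpace.basisFun _ ℝ).toBasis.det (productFrame x y a b) =
      productFrameSign m n * (EuclideanSpace.basisFun _ ℝ).toBasis.det (Fin.cons x a) *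
        (EuclideanSpace.basisFun _ ℝ).toBasis.det (Fin.cons y b) *
        resultant (polyOfCoeffs x) (polyOfCoeffs y) m n := by
  have hdense : Dense {x : EuclideanSpace ℝ (Fin (m + 1)) | x (Fin.last m) ≠ 0} := by
    refine (dense_compl_singleton (0 : ℝ)).preimage
      (ContinuousLinearMap.isOpenMap (EuclideanSpace.proj (𝕜 := ℝ) (Fin.last m)) fun r => ?_)
    exact ⟨EuclideanSpace.single (Fin.last m) r, by simp⟩
  refine congrFun (Continuous.ext_on hdense ?_ ?_ fun x hx =>
    det_productFrame_of_last_ne_zero hx y a b) x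
  · refine continuous_basisFun_det.comp (continuous_pi fun j => ?_)
    simp only [productFrame]
    cases j using Fin.cases with
    | zero => exact continuous_polyMul_left y
    | succ j =>
      induction j using Fin.addCases with
      | left j => simpa using continuous_const
      | right j => simpa using continuous_polyMul_left (b j)
  · refine ((continuous_const.mul (continuous_basisFun_det.comp (continuous_pi fun j => ?_))).mul
      continuous_const).mul ?_
    · cases j using Fin.cases with
      | zero => exact continuous_id
      | succ j => exact continuous_const
    · refine Continuous.matrix_det (continuous_matrix fun i j => ?_)
      simp only [sylvester, Matrix.of_apply]
      induction j using Fin.addCases with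
      | left j => simpa using continuous_const
      | right j =>
        simp only [Fin.addCases_right]
        split_ifs
        exacts [continuous_polyOfCoeffs_coeff _ _, continuous_const]

/-! ## The differential of the multiplication map of spheres -/

/-- The differential of the inclusion of the sphere. -/
def sphereIncl {d : ℕ} (x : USphere d) : TangentSpace (𝓡 d) x →L[ℝ] EuclideanSpace ℝ (Fin (d + 1)) :=
  mvfderiv (𝓡 d) (fun z : USphere d => (z : EuclideanSpace ℝ (Fin (d + 1)))) x

theorem contMDiff_coe_usphere (d : ℕ) :
    ContMDiff (𝓡 d) 𝓘(ℝ, EuclideanSpace ℝ (Fin (d + 1))) ω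
      (fun z : USphere d => (z : EuclideanSpace ℝ (Fin (d + 1)))) :=
  haveI := Fact.mk (@finrank_euclideanSpace_fin ℝ _ (d + 1))
  contMDiff_coe_sphere

theorem sphereIncl_injective {d : ℕ} (x : USphere d) : Function.Injective (sphereIncl x) :=
  haveI := Fact.mk (@finrank_euclideanSpace_fin ℝ _ (d + 1))
  injective_mvfderiv_subtypeVal_sphere x

theorem range_sphereIncl {d : ℕ} (x : USphere d) :
    (sphereIncl x).range = (ℝ ∙ (x : EuclideanSpace ℝ (Fin (d + 1))))ᗮ :=
  haveI := Fact.mk (@finrank_euclideanSpace_fin ℝ _ (d + 1))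
  range_mvfderiv_subtypeVal x

theorem hasMFDerivAt_coe_usphere {d : ℕ} (x : USphere d) :
    HasMFDerivAt (𝓡 d) 𝓘(ℝ, EuclideanSpace ℝ (Fin (d + 1)))
      (fun z : USphere d => (z : EuclideanSpace ℝ (Fin (d + 1)))) x (sphereIncl x) :=
  ((contMDiff_coe_usphere d x).mdifferentiableAt (by simp)).hasMFDerivAt

/-- Multiplication of polynomials in coefficients, as a continuous bilinear map. -/
def polyMulL (m n : ℕ) : EuclideanSpace ℝ (Fin (m + 1)) →L[ℝ] EuclideanSpace ℝ (Fin (n + 1)) →L[ℝ]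
    EuclideanSpace ℝ (Fin (m + n + 1)) :=
  (LinearMap.toContinuousLinearMap.toLinearMap ∘ₗ (polyMulₗ m n)).toContinuousLinearMap

theorem contDiff_polyMul (m n : ℕ) : ContDiff ℝ ω
    fun p : EuclideanSpace ℝ (Fin (m + 1)) × EuclideanSpace ℝ (Fin (n + 1)) => polyMul p.1 p.2 :=
  (polyMulL m n).isBoundedBilinearMap.contDiff

/-- Normalized multiplication of polynomials in coefficients. -/
def normalizedMul (m n : ℕ) (p : EuclideanSpace ℝ (Fin (m + 1)) × EuclideanSpace ℝ (Fin (n + 1))) :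
    EuclideanSpace ℝ (Fin (m + n + 1)) :=
  ‖polyMul p.1 p.2‖⁻¹ • polyMul p.1 p.2

theorem coe_mulSphere {m n : ℕ} (z : USphere m × USphere n) :
    (mulSphere m n z : EuclideanSpace ℝ (Fin (m + n + 1))) = normalizedMul m n (z.1, z.2) := rfl

theorem polyMul_coe_ne_zero {m n : ℕ} (z : USphere m × USphere n) :
    polyMul (z.1 : EuclideanSpace ℝ (Fin (m + 1))) (z.2 : EuclideanSpace ℝ (Fin (n + 1))) ≠ 0 :=
  polyMul_ne_zero (ne_zero_of_mem_unit_sphere z.1) (ne_zero_of_mem_unit_sphere z.2)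

theorem contDiffAt_normalizedMul {m n : ℕ} {x : EuclideanSpace ℝ (Fin (m + 1))}
    {y : EuclideanSpace ℝ (Fin (n + 1))} (h0 : polyMul x y ≠ 0) :
    ContDiffAt ℝ ω (normalizedMul m n) (x, y) := by
  have h1 : ContDiffAt ℝ ω (fun p : EuclideanSpace ℝ (Fin (m + 1)) ×
      EuclideanSpace ℝ (Fin (n + 1)) => polyMul p.1 p.2) (x, y) := (contDiff_polyMul m n).contDiffAt
  have h2 : ContDiffAt ℝ ω (fun p : EuclideanSpace ℝ (Fin (m + 1)) ×
      EuclideanSpace ℝ (Fin (n + 1)) => ‖polyMul p.1 p.2‖⁻¹) (x, y) :=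
    (h1.norm ℝ h0).inv (by simpa using h0)
  exact h2.smul h1

theorem contMDiff_normalizedMul_coe (m n : ℕ) :
    ContMDiff ((𝓡 m).prod (𝓡 n)) 𝓘(ℝ, EuclideanSpace ℝ (Fin (m + n + 1))) ω
      fun z : USphere m × USphere n => normalizedMul m n (z.1, z.2) := by
  have h1 : ContMDiff ((𝓡 m).prod (𝓡 n))
      𝓘(ℝ, EuclideanSpace ℝ (Fin (m + 1)) × EuclideanSpace ℝ (Fin (n + 1))) ω
      fun z : USphere m × USphere n => ((z.1 : EuclideanSpace ℝ (Fin (m + 1))),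
        (z.2 : EuclideanSpace ℝ (Fin (n + 1)))) :=
    ((contMDiff_coe_usphere m).comp contMDiff_fst).prodMk_space
      ((contMDiff_coe_usphere n).comp contMDiff_snd)
  intro z
  have h2 := contDiffAt_normalizedMul (polyMul_coe_ne_zero z)
  exact ContMDiffAt.comp (g := normalizedMul m n) z h2.contMDiffAt (h1 z)

theorem contMDiff_mulSphere (m n : ℕ) :
    ContMDiff ((𝓡 m).prod (𝓡 n)) (𝓡 (m + n)) ω (mulSphere m n) := by
  have := Fact.mk (@finrank_euclideanSpace_fin ℝ _ (m + n + 1))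
  have h : ∀ z : USphere m × USphere n, normalizedMul m n (z.1, z.2) ∈
      Metric.sphere (0 : EuclideanSpace ℝ (Fin (m + n + 1))) 1 := fun z => by
    rw [← coe_mulSphere]
    exact Subtype.coe_prop _
  have e : mulSphere m n = Set.codRestrict _ _ h := funext fun z => Subtype.ext rfl
  rw [e]
  exact (contMDiff_normalizedMul_coe m n).codRestrict_sphere h

/-- The derivative of normalized multiplication. -/
theorem exists_hasFDerivAt_normalized_polyMul {m n : ℕ} {x : EuclideanSpace ℝ (Fin (m + 1))}
    {y : EuclideanSpace ℝ (Fin (n + 1))} (h0 : polyMul x y ≠ 0) :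
    ∃ (G : EuclideanSpace ℝ (Fin (m + 1)) × EuclideanSpace ℝ (Fin (n + 1)) →L[ℝ]
        EuclideanSpace ℝ (Fin (m + n + 1)))
      (ℓ : EuclideanSpace ℝ (Fin (m + 1)) × EuclideanSpace ℝ (Fin (n + 1)) → ℝ),
      HasFDerivAt (normalizedMul m n) G (x, y) ∧
      ∀ u w, G (u, w) = ‖polyMul x y‖⁻¹ • (polyMul u y + polyMul x w) + ℓ (u, w) • polyMul x y := by
  have h1 : HasFDerivAt (fun p : EuclideanSpace ℝ (Fin (m + 1)) × EuclideanSpace ℝ (Fin (n + 1)) =>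
      polyMul p.1 p.2) ((polyMulL m n).deriv₂ (x, y)) (x, y) :=
    (polyMulL m n).isBoundedBilinearMap.hasFDerivAt (x, y)
  have h2 : DifferentiableAt ℝ (fun p : EuclideanSpace ℝ (Fin (m + 1)) ×
      EuclideanSpace ℝ (Fin (n + 1)) => ‖polyMul p.1 p.2‖⁻¹) (x, y) :=
    (h1.differentiableAt.norm ℝ h0).inv (by simpa using h0)
  set φ := fderiv ℝ (fun p : EuclideanSpace ℝ (Fin (m + 1)) ×
    EuclideanSpace ℝ (Fin (n + 1)) => ‖polyMul p.1 p.2‖⁻¹) (x, y)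
  have h3 : HasFDerivAt (normalizedMul m n)
    (‖polyMul x y‖⁻¹ • (polyMulL m n).deriv₂ (x, y) + φ.smulRight (polyMul x y)) (x, y) :=
    h2.hasFDerivAt.smul h1
  refine ⟨_, φ, h3, fun u w => ?_⟩
  rw [add_comm (polyMul u y)]
  rfl

theorem hasMFDerivAt_coe_prod {m n : ℕ} (x : USphere m) (y : USphere n) :
    HasMFDerivAt ((𝓡 m).prod (𝓡 n))
      𝓘(ℝ, EuclideanSpace ℝ (Fin (m + 1)) × EuclideanSpace ℝ (Fin (n + 1)))
      (fun z : USphere m × USphere n => ((z.1 : EuclideanSpace ℝ (Fin (m + 1))),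
        (z.2 : EuclideanSpace ℝ (Fin (n + 1))))) (x, y)
      ((sphereIncl x).prodMap (sphereIncl y)) := by
  have h1 := (hasMFDerivAt_coe_usphere x).comp (x, y) (hasMFDerivAt_fst (I := 𝓡 m) (I' := 𝓡 n) (x, y))
  have h2 := (hasMFDerivAt_coe_usphere y).comp (x, y) (hasMFDerivAt_snd (I := 𝓡 m) (I' := 𝓡 n) (x, y))
  exact ⟨h1.1.prodMk h2.1, h1.2.prodMk h2.2⟩

/-- The chain rule through the ambient spaces. The coefficient `ℓ` need not be known: multiples of
`x * y` disappear from determinants whose first column is the base point. -/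
theorem sphereIncl_mfderiv_mulSphere {m n : ℕ} (x : USphere m) (y : USphere n) :
    ∃ ℓ : EuclideanSpace ℝ (Fin (m + 1)) × EuclideanSpace ℝ (Fin (n + 1)) → ℝ,
      ∀ (v : TangentSpace (𝓡 m) x) (w : TangentSpace (𝓡 n) y),
      sphereIncl (mulSphere m n (x, y)) (prodDeriv (mulSphere m n) (x, y) v w) =
        ‖polyMul x.1 y.1‖⁻¹ • (polyMul (sphereIncl x v) y.1 + polyMul x.1 (sphereIncl y w)) +
        ℓ (sphereIncl x v, sphereIncl y w) • polyMul x.1 y.1 := by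
  obtain ⟨G, ℓ, hG, hGℓ⟩ := exists_hasFDerivAt_normalized_polyMul (polyMul_coe_ne_zero (x, y))
  refine ⟨ℓ, fun v w => ?_⟩
  rw [← hGℓ]
  have h1 := (hasMFDerivAt_coe_usphere (mulSphere m n (x, y))).comp (x, y)
    (((contMDiff_mulSphere m n) (x, y)).mdifferentiableAt (by simp)).hasMFDerivAt
  have h2 := hG.hasMFDerivAt.comp (x, y) (hasMFDerivAt_coe_prod x y)
  have h4 := hasMFDerivAt_unique h1 h2
  exact congrArg (fun φ => φ (v, w)) h4

/-! ## The local degree and the resultant -/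

theorem basisFun_det_ne_zero_iff {d : ℕ} (v : Fin d → EuclideanSpace ℝ (Fin d)) :
    (EuclideanSpace.basisFun (Fin d) ℝ).toBasis.det v ≠ 0 ↔ LinearIndependent ℝ v := by
  rw [← isUnit_iff_ne_zero, ← Module.Basis.is_basis_iff_det]
  exact ⟨fun h => h.1, fun h => ⟨h, h.span_eq_top_of_card_eq_finrank' (by simp)⟩⟩

/-- The determinant of `(c u, c wᵢ + tᵢ u)`. -/
theorem basisFun_det_cons_smul_add {d : ℕ} {c : ℝ} (hc : c ≠ 0)
    (u : EuclideanSpace ℝ (Fin (d + 1))) (w : Fin d → EuclideanSpace ℝ (Fin (d + 1)))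
    (t : Fin d → ℝ) :
    (EuclideanSpace.basisFun _ ℝ).toBasis.det (Fin.cons (c • u) fun i => c • w i + t i • u) =
      c ^ (d + 1) * (EuclideanSpace.basisFun _ ℝ).toBasis.det (Fin.cons u w) := by
  have h1 : (EuclideanSpace.basisFun _ ℝ).toBasis.det (c • Fin.cons u w) =
      c ^ (d + 1) * (EuclideanSpace.basisFun _ ℝ).toBasis.det (Fin.cons u w) := by
    have := (EuclideanSpace.basisFun (Fin (d + 1)) ℝ).toBasis.det.map_smul_univ (fun _ => c)
      (Fin.cons u w)
    rw [Finset.prod_const, Finset.card_univ, Fintype.card_fin] at this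
    exact this
  rw [← h1, basisFun_det_eq, basisFun_det_eq, ← Matrix.det_transpose,
    ← Matrix.det_transpose (Matrix.of _)]
  refine Matrix.det_eq_of_forall_row_eq_smul_add_const (Fin.cons 0 fun i => t i / c) 0 rfl
    fun j i => ?_
  cases j using Fin.cases with
  | zero => simp
  | succ j =>
    simp only [Matrix.transpose_apply, Matrix.of_apply, Fin.cons_succ, Pi.smul_apply, Fin.cons_zero,
      PiLp.add_apply, PiLp.smul_apply, smul_eq_mul]
    field_simp

/-- Tangent vectors are orthogonal to the base point, so the unit vector `x` never lies in their
span. -/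
theorem basisFun_det_cons_sphereIncl_ne_zero_iff {d : ℕ} (x : USphere d)
    (v : Fin d → TangentSpace (𝓡 d) x) :
    (EuclideanSpace.basisFun _ ℝ).toBasis.det
      (Fin.cons (x : EuclideanSpace ℝ (Fin (d + 1))) fun i => sphereIncl x (v i)) ≠ 0 ↔
      LinearIndependent ℝ v := by
  rw [basisFun_det_ne_zero_iff, linearIndependent_finCons]
  have hli : LinearIndependent ℝ (fun i => sphereIncl x (v i)) ↔ LinearIndependent ℝ v :=
    LinearMap.linearIndependent_iff (sphereIncl x).toLinearMap
      (LinearMap.ker_eq_bot.2 (sphereIncl_injective x))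
  rw [hli, and_iff_left_iff_imp]
  intro _ hx
  have h1 : (x : EuclideanSpace ℝ (Fin (d + 1))) ∈ (sphereIncl x).range := by
    refine (Submodule.span_le.2 ?_) hx
    rintro _ ⟨i, rfl⟩
    exact ⟨v i, rfl⟩
  rw [range_sphereIncl, Submodule.mem_orthogonal_singleton_iff_inner_right, inner_self_eq_zero] at h1
  exact ne_zero_of_mem_unit_sphere x h1

theorem linearIndependent_chartFrame {d : ℕ} (x : USphere d) :
    LinearIndependent ℝ (chartFrame x) := by
  have := (EuclideanSpace.basisFun (Fin d) ℝ).toBasis.linearIndependent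
  have e : (EuclideanSpace.basisFun (Fin d) ℝ).toBasis =
      fun i => (EuclideanSpace.single i (1 : ℝ) : EuclideanSpace ℝ (Fin d)) := by
    funext i
    simp
  rw [e] at this
  exact this

theorem surjective_iff_linearIndependent_append {m n : ℕ}
    (T : EuclideanSpace ℝ (Fin m) × EuclideanSpace ℝ (Fin n) →ₗ[ℝ] EuclideanSpace ℝ (Fin (m + n))) :
    Function.Surjective T ↔ LinearIndependent ℝ (Fin.append
      (fun i => T (EuclideanSpace.single i 1, 0)) (fun j => T (0, EuclideanSpace.single j 1))) := by
  set b := ((EuclideanSpace.basisFun (Fin m) ℝ).toBasis.prod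
    (EuclideanSpace.basisFun (Fin n) ℝ).toBasis).reindex finSumFinEquiv
  have hb : Fin.append (fun i => T (EuclideanSpace.single i 1, 0))
      (fun j => T (0, EuclideanSpace.single j 1)) = T ∘ b := by
    ext j : 1
    induction j using Fin.addCases <;> simp [b]
  rw [hb]
  constructor
  · intro h
    have hinj : Function.Injective T :=
      (LinearMap.injective_iff_surjective_of_finrank_eq_finrank (by simp)).2 h
    exact b.linearIndependent.map' T (LinearMap.ker_eq_bot.2 hinj)
  · intro h
    rw [← LinearMap.range_eq_top, eq_top_iff, ← h.span_eq_top_of_card_eq_finrank' (by simp),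
      Submodule.span_le]
    rintro _ ⟨i, rfl⟩
    exact ⟨b i, rfl⟩

/-- The image of the chart frames under the differential of the multiplication map. -/
def imageFrame {m n : ℕ} (x : USphere m) (y : USphere n) :
    Fin (m + n) → TangentSpace (𝓡 (m + n)) (mulSphere m n (x, y)) :=
  Fin.append (fun i => prodDeriv (mulSphere m n) (x, y) (chartFrame x i) 0)
    (fun j => prodDeriv (mulSphere m n) (x, y) 0 (chartFrame y j))

theorem det_imageFrame {m n : ℕ} (x : USphere m) (y : USphere n) :
    (EuclideanSpace.basisFun _ ℝ).toBasis.det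
      (Fin.cons (mulSphere m n (x, y) : EuclideanSpace ℝ (Fin (m + n + 1)))
        fun i => sphereIncl _ (imageFrame x y i)) =
      ‖polyMul x.1 y.1‖⁻¹ ^ (m + n + 1) * (EuclideanSpace.basisFun _ ℝ).toBasis.det
        (productFrame x.1 y.1 (fun i => sphereIncl x (chartFrame x i))
          (fun j => sphereIncl y (chartFrame y j))) := by
  obtain ⟨ℓ, hℓ⟩ := sphereIncl_mfderiv_mulSphere x y
  have h0 : ‖polyMul x.1 y.1‖⁻¹ ≠ 0 := by simpa using polyMul_coe_ne_zero (x, y)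
  rw [productFrame, ← basisFun_det_cons_smul_add h0 _ _ (Fin.append
    (fun i => ℓ (sphereIncl x (chartFrame x i), sphereIncl y 0))
    (fun j => ℓ (sphereIncl x 0, sphereIncl y (chartFrame y j))))]
  congr 2
  ext i : 1
  have hl : ∀ u, polyMul u y.1 + polyMul x.1 (0 : EuclideanSpace ℝ (Fin (n + 1))) =
      polyMul u y.1 := fun u => by
    rw [← polyMulₗ_apply x.1, map_zero, add_zero]
  have hr : ∀ w, polyMul (0 : EuclideanSpace ℝ (Fin (m + 1))) y.1 + polyMul x.1 w =
      polyMul x.1 w := fun w => by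
    rw [← polyMulₗ_apply _ y.1, map_zero, LinearMap.zero_apply, zero_add]
  induction i using Fin.addCases with
  | left i =>
    simp only [imageFrame, Fin.append_left]
    rw [hℓ]
    simp only [map_zero, hl]
  | right j =>
    simp only [imageFrame, Fin.append_right]
    rw [hℓ]
    simp only [map_zero, hr]

/-- The resultant of the two factors, as forms of degrees `m` and `n`. -/
def sphereResultant {m n : ℕ} (z : USphere m × USphere n) : ℝ :=
  resultant (polyOfCoeffs z.1.1) (polyOfCoeffs z.2.1) m n

theorem surjective_mfderiv_mulSphere_iff {m n : ℕ} (z : USphere m × USphere n) :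
    Function.Surjective (mfderiv ((𝓡 m).prod (𝓡 n)) (𝓡 (m + n)) (mulSphere m n) z) ↔
      sphereResultant z ≠ 0 := by
  obtain ⟨x, y⟩ := z
  have h1 : Function.Surjective (mfderiv ((𝓡 m).prod (𝓡 n)) (𝓡 (m + n)) (mulSphere m n) (x, y)) ↔
      LinearIndependent ℝ (imageFrame x y) :=
    surjective_iff_linearIndependent_append
      (mfderiv ((𝓡 m).prod (𝓡 n)) (𝓡 (m + n)) (mulSphere m n) (x, y)).toLinearMap
  have h0 : ‖polyMul x.1 y.1‖⁻¹ ≠ 0 := by simpa using polyMul_coe_ne_zero (x, y)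
  have hx := (basisFun_det_cons_sphereIncl_ne_zero_iff x _).2 (linearIndependent_chartFrame x)
  have hy := (basisFun_det_cons_sphereIncl_ne_zero_iff y _).2 (linearIndependent_chartFrame y)
  have hs : (productFrameSign m n : ℝ) ≠ 0 := by
    rcases productFrameSign_eq m n with h | h <;> simp [h]
  rw [h1, ← basisFun_det_cons_sphereIncl_ne_zero_iff, det_imageFrame, det_productFrame,
    mul_ne_zero_iff_left (pow_ne_zero _ h0),
    mul_ne_zero_iff_left (mul_ne_zero (mul_ne_zero hs hx) hy)]
  rfl

/-- The frame signs at `x` and `y` occur once in the definition and once in the determinant of the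
image frame, so they square to one. -/
theorem localDegree_mulSphere {m n : ℕ} (z : USphere m × USphere n) :
    localDegree (mulSphere m n) z =
      productFrameSign m n * SignType.sign (sphereResultant z) := by
  obtain ⟨x, y⟩ := z
  have h0 : 0 < ‖polyMul x.1 y.1‖⁻¹ := by simpa using polyMul_coe_ne_zero (x, y)
  have hx := (basisFun_det_cons_sphereIncl_ne_zero_iff x _).2 (linearIndependent_chartFrame x)
  have hy := (basisFun_det_cons_sphereIncl_ne_zero_iff y _).2 (linearIndependent_chartFrame y)
  have e1 : frameSign x (chartFrame x) = SignType.sign ((EuclideanSpace.basisFun _ ℝ).toBasis.det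
    (Fin.cons x.1 fun i => sphereIncl x (chartFrame x i))) := rfl
  have e2 : frameSign y (chartFrame y) = SignType.sign ((EuclideanSpace.basisFun _ ℝ).toBasis.det
    (Fin.cons y.1 fun i => sphereIncl y (chartFrame y i))) := rfl
  have e3 : frameSign (mulSphere m n (x, y)) (imageFrame x y) =
    SignType.sign ((EuclideanSpace.basisFun _ ℝ).toBasis.det
      (Fin.cons (mulSphere m n (x, y) : EuclideanSpace ℝ (Fin (m + n + 1)))
        fun i => sphereIncl _ (imageFrame x y i))) := rfl
  have e : localDegree (mulSphere m n) (x, y) = frameSign x (chartFrame x) *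
    frameSign y (chartFrame y) * frameSign (mulSphere m n (x, y)) (imageFrame x y) := rfl
  have hsq : ∀ r : ℝ, r ≠ 0 → (SignType.sign r : ℤ) * SignType.sign r = 1 := fun r hr => by
    rcases hr.lt_or_gt with h | h
    · simp [sign_neg h]
    · simp [sign_pos h]
  have hsign : (SignType.sign (productFrameSign m n : ℝ) : ℤ) = productFrameSign m n := by
    rcases productFrameSign_eq m n with h | h <;> simp [h]
  rw [e, e1, e2, e3, det_imageFrame, det_productFrame, sign_mul, sign_pos (pow_pos h0 _), one_mul,
    sign_mul, sign_mul, sign_mul]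
  push_cast
  rw [hsign]
  simp only [sphereResultant]
  linear_combination (productFrameSign m n : ℤ) *
    SignType.sign (resultant (polyOfCoeffs x.1) (polyOfCoeffs y.1) m n) *
    (hsq _ hx * (SignType.sign ((EuclideanSpace.basisFun _ ℝ).toBasis.det
      (Fin.cons y.1 fun i => sphereIncl y (chartFrame y i))) : ℤ) *
      (SignType.sign ((EuclideanSpace.basisFun _ ℝ).toBasis.det
      (Fin.cons y.1 fun i => sphereIncl y (chartFrame y i))) : ℤ) + hsq _ hy)

/-! ## Projective changes of the variable -/

theorem det_submatrix_perm_perm {N : ℕ} (σ τ : Equiv.Perm (Fin N)) (M : Matrix (Fin N) (Fin N) ℝ) :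
    (M.submatrix σ τ).det = ((Equiv.Perm.sign σ * Equiv.Perm.sign τ : ℤˣ) : ℤ) * M.det := by
  have : M.submatrix σ τ = (M.submatrix id τ).submatrix σ id := by ext; simp
  rw [this, Matrix.det_permute, Matrix.det_permute']
  push_cast
  ring

/-- Reversal of both blocks of `Fin (m + n)`. -/
def blockRev (m n : ℕ) : Equiv.Perm (Fin (m + n)) :=
  finSumFinEquiv.symm.trans ((Equiv.sumCongr Fin.revPerm Fin.revPerm).trans finSumFinEquiv)

/-- The sign by which resultants change under reversal of the coefficients. -/
def reflectSign (m n : ℕ) : ℤ :=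
  ((Equiv.Perm.sign (Fin.revPerm : Equiv.Perm (Fin (m + n))) *
    Equiv.Perm.sign (blockRev m n) : ℤˣ) : ℤ)

theorem reflectSign_eq (m n : ℕ) : reflectSign m n = 1 ∨ reflectSign m n = -1 := by
  rw [reflectSign]
  rcases Int.units_eq_one_or (Equiv.Perm.sign (Fin.revPerm : Equiv.Perm (Fin (m + n))) *
    Equiv.Perm.sign (blockRev m n)) with h | h <;> simp [h]

/-- Reversing coefficients reverses the rows of the Sylvester matrix and the columns within each of
its two blocks. -/
theorem resultant_reflect (m n : ℕ) (p q : ℝ[X]) :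
    resultant (reflect m p) (reflect n q) m n = reflectSign m n * resultant p q m n := by
  rw [resultant, resultant, reflectSign, ← det_submatrix_perm_perm]
  congr 1
  ext i j
  have hi := i.2
  induction j using Fin.addCases with
  | left j =>
    have hj : blockRev m n (Fin.castAdd n j) = Fin.castAdd n j.rev := by simp [blockRev]
    have hj2 := j.2
    rw [Matrix.submatrix_apply, hj]
    simp only [sylvester, Matrix.of_apply, Fin.addCases_left, Set.mem_Icc, Fin.revPerm_apply,
      Fin.val_rev, coeff_reflect]
    by_cases h : (j : ℕ) ≤ i ∧ (i : ℕ) ≤ j + n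
    · rw [if_pos h, if_pos (by omega), revAt_le (by omega)]
      congr 1
      omega
    · rw [if_neg h, if_neg (by omega)]
  | right j =>
    have hj : blockRev m n (Fin.natAdd m j) = Fin.natAdd m j.rev := by simp [blockRev]
    have hj2 := j.2
    rw [Matrix.submatrix_apply, hj]
    simp only [sylvester, Matrix.of_apply, Fin.addCases_right, Set.mem_Icc, Fin.revPerm_apply,
      Fin.val_rev, coeff_reflect]
    by_cases h : (j : ℕ) ≤ i ∧ (i : ℕ) ≤ j + m
    · rw [if_pos h, if_pos (by omega), revAt_le (by omega)]
      congr 1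
      omega
    · rw [if_neg h, if_neg (by omega)]

/-- If both degrees drop, both resultants vanish. Otherwise raising one formal degree contributes a
sign and a power of the other polynomial's leading coefficient, which translation preserves. -/
theorem resultant_taylor_of_natDegree_le {m n : ℕ} {p q : ℝ[X]} (hp : p.natDegree ≤ m)
    (hq : q.natDegree ≤ n) (t : ℝ) :
    resultant (taylor t p) (taylor t q) m n = resultant p q m n := by
  have hcoeff : ∀ r : ℝ[X], (taylor t r).coeff r.natDegree = r.coeff r.natDegree := fun r => by
    simp
  rcases hp.lt_or_eq with hp' | rfl
  · rcases hq.lt_or_eq with hq' | rfl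
    · rw [resultant_eq_zero_of_lt_lt _ _ _ _ (by simpa) (by simpa),
        resultant_eq_zero_of_lt_lt _ _ _ _ hp' hq']
    · obtain ⟨c, rfl⟩ := le_iff_exists_add.1 hp
      rw [resultant_add_left_deg _ _ _ _ _ (by simp), resultant_add_left_deg _ _ _ _ _ le_rfl,
        hcoeff]
      have := resultant_taylor p q t
      simp only [natDegree_taylor] at this
      rw [this]
  · obtain ⟨c, rfl⟩ := le_iff_exists_add.1 hq
    rw [resultant_add_right_deg _ _ _ _ _ (by simp), resultant_add_right_deg _ _ _ _ _ le_rfl,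
      hcoeff]
    have := resultant_taylor p q t
    simp only [natDegree_taylor] at this
    rw [this]

/-- The polynomial `X ^ m * p (1 / X + t)`, for `p` of degree at most `m`. -/
def shiftReflect (m : ℕ) (t : ℝ) (p : ℝ[X]) : ℝ[X] := reflect m (taylor t p)

theorem natDegree_reflect_le_of_le {m : ℕ} {p : ℝ[X]} (hp : p.natDegree ≤ m) :
    (reflect m p).natDegree ≤ m :=
  natDegree_le_iff_coeff_eq_zero.2 fun N hN => by
    rw [coeff_reflect, revAt_eq_self_of_lt hN]
    exact coeff_eq_zero_of_natDegree_lt (by omega)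

theorem natDegree_shiftReflect_le {m : ℕ} {p : ℝ[X]} (hp : p.natDegree ≤ m) (t : ℝ) :
    (shiftReflect m t p).natDegree ≤ m :=
  natDegree_reflect_le_of_le (by simpa)

theorem coeff_shiftReflect (m : ℕ) (t : ℝ) (p : ℝ[X]) :
    (shiftReflect m t p).coeff m = p.eval t := by
  rw [shiftReflect, coeff_reflect, revAt_le le_rfl, Nat.sub_self, taylor_coeff_zero]

theorem shiftReflect_mul {m n : ℕ} {p q : ℝ[X]} (hp : p.natDegree ≤ m) (hq : q.natDegree ≤ n)
    (t : ℝ) : shiftReflect (m + n) t (p * q) = shiftReflect m t p * shiftReflect n t q := by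
  rw [shiftReflect, taylor_mul, reflect_mul _ _ (by simpa) (by simpa)]
  rfl

theorem shiftReflect_C_mul (m : ℕ) (t c : ℝ) (p : ℝ[X]) :
    shiftReflect m t (C c * p) = C c * shiftReflect m t p := by
  rw [shiftReflect, taylor_mul, taylor_C, reflect_C_mul]
  rfl

theorem shiftReflect_injective (m : ℕ) (t : ℝ) : Function.Injective (shiftReflect m t) :=
  fun p q h => by
    have := congrArg (reflect m) h
    simp only [shiftReflect, reflect_reflect] at this
    exact taylor_injective t this

theorem exists_shiftReflect_eq {m : ℕ} (t : ℝ) {r : ℝ[X]} (hr : r.natDegree ≤ m) :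
    ∃ p : ℝ[X], p.natDegree ≤ m ∧ shiftReflect m t p = r :=
  ⟨taylor (-t) (reflect m r), by simpa using natDegree_reflect_le_of_le hr, by
    rw [shiftReflect, taylor_taylor, add_neg_cancel, taylor_zero, reflect_reflect]⟩

theorem resultant_shiftReflect {m n : ℕ} {p q : ℝ[X]} (hp : p.natDegree ≤ m) (hq : q.natDegree ≤ n)
    (t : ℝ) : resultant (shiftReflect m t p) (shiftReflect n t q) m n =
      reflectSign m n * resultant p q m n := by
  rw [shiftReflect, shiftReflect, resultant_reflect, resultant_taylor_of_natDegree_le hp hq]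

/-! ## The fibres of the multiplication map -/

theorem mulSphere_eq_iff {m n : ℕ} (z : USphere m × USphere n) (y : USphere (m + n)) :
    mulSphere m n z = y ↔
      ∃ c : ℝ, 0 < c ∧ polyOfCoeffs z.1.1 * polyOfCoeffs z.2.1 = C c * polyOfCoeffs y.1 := by
  have h0 := polyMul_coe_ne_zero z
  constructor
  · rintro rfl
    refine ⟨‖polyMul z.1.1 z.2.1‖, norm_pos_iff.2 h0, ?_⟩
    rw [← polyOfCoeffs_smul, ← polyOfCoeffs_polyMul, coe_mulSphere, normalizedMul, smul_smul,
      mul_inv_cancel₀ (norm_ne_zero_iff.2 h0), one_smul]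
  · rintro ⟨c, hc, h⟩
    rw [← polyOfCoeffs_smul, ← polyOfCoeffs_polyMul] at h
    have h1 := polyOfCoeffs_injective h
    ext1
    rw [coe_mulSphere, normalizedMul, h1, norm_smul, norm_eq_of_mem_sphere, mul_one,
      Real.norm_of_nonneg hc.le, smul_smul, inv_mul_cancel₀ hc.ne', one_smul]

/-- The monic polynomial of degree `m` proportional to `X ^ m * p (1 / X + t)`. -/
def monicShift {m : ℕ} (t : ℝ) (x : USphere m) : ℝ[X] :=
  C ((polyOfCoeffs x.1).eval t)⁻¹ * shiftReflect m t (polyOfCoeffs x.1)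

section MonicShift

variable {m n : ℕ} {t : ℝ}

theorem C_eval_mul_monicShift {x : USphere m} (hx : (polyOfCoeffs x.1).eval t ≠ 0) :
    C ((polyOfCoeffs x.1).eval t) * monicShift t x = shiftReflect m t (polyOfCoeffs x.1) := by
  rw [monicShift, ← mul_assoc, ← C_mul, mul_inv_cancel₀ hx, C_1, one_mul]

theorem natDegree_monicShift_le (x : USphere m) : (monicShift t x).natDegree ≤ m :=
  (natDegree_C_mul_le _ _).trans (natDegree_shiftReflect_le (polyOfCoeffs_natDegree_le x.1) t)

theorem coeff_monicShift {x : USphere m} (hx : (polyOfCoeffs x.1).eval t ≠ 0) :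
    (monicShift t x).coeff m = 1 := by
  rw [monicShift, coeff_C_mul, coeff_shiftReflect, inv_mul_cancel₀ hx]

theorem monic_monicShift {x : USphere m} (hx : (polyOfCoeffs x.1).eval t ≠ 0) :
    (monicShift t x).Monic :=
  monic_of_natDegree_le_of_coeff_eq_one m (natDegree_monicShift_le x) (coeff_monicShift hx)

theorem natDegree_monicShift {x : USphere m} (hx : (polyOfCoeffs x.1).eval t ≠ 0) :
    (monicShift t x).natDegree = m :=
  le_antisymm (natDegree_monicShift_le x)
    (le_natDegree_of_ne_zero (by rw [coeff_monicShift hx]; exact one_ne_zero))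

/-- Equal monic forms mean proportional vectors; the common sign at `t` makes the ratio positive and
the unit norms make it `1`. -/
theorem monicShift_injOn {x x' : USphere m}
    (hx : 0 < (polyOfCoeffs x.1).eval t * (polyOfCoeffs x'.1).eval t)
    (h : monicShift t x = monicShift t x') : x = x' := by
  have hx1 := left_ne_zero_of_mul hx.ne'
  have hx2 := right_ne_zero_of_mul hx.ne'
  set a := (polyOfCoeffs x.1).eval t
  set a' := (polyOfCoeffs x'.1).eval t
  have h1 : shiftReflect m t (polyOfCoeffs x.1) =
      shiftReflect m t (polyOfCoeffs ((a / a') • x'.1)) := by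
    rw [polyOfCoeffs_smul, shiftReflect_C_mul, ← C_eval_mul_monicShift hx1,
      ← C_eval_mul_monicShift hx2, h, ← mul_assoc, ← C_mul, div_mul_cancel₀ _ hx2]
  have h2 := polyOfCoeffs_injective (shiftReflect_injective m t h1)
  have h3 : 0 < a / a' := by
    have : a / a' = a * a' / a' ^ 2 := by field_simp
    rw [this]
    exact div_pos hx (by positivity)
  have h4 : a / a' = 1 := by
    have := congrArg norm h2
    rw [norm_smul, norm_eq_of_mem_sphere, norm_eq_of_mem_sphere, mul_one,
      Real.norm_of_nonneg h3.le] at this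
    exact this.symm
  ext1
  rw [h2, h4, one_smul]

theorem exists_monicShift_eq {p : ℝ[X]} (hp : p.Monic) (hd : p.natDegree = m) {s : ℝ}
    (hs : s ≠ 0) : ∃ x : USphere m, monicShift t x = p ∧ 0 < s * (polyOfCoeffs x.1).eval t := by
  obtain ⟨q, hq, hqp⟩ := exists_shiftReflect_eq t hd.le
  set v : EuclideanSpace ℝ (Fin (m + 1)) := WithLp.toLp 2 fun i => q.coeff i
  have hv : polyOfCoeffs v = q := polyOfCoeffs_toLp_coeff hq
  have hqt : q.eval t = 1 := by
    rw [← coeff_shiftReflect m, hqp, ← hd, hp.coeff_natDegree]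
  have hv0 : s • v ≠ 0 := by
    refine smul_ne_zero hs fun h => ?_
    rw [← hv, h, ← polyOfCoeffsₗ_apply, map_zero, eval_zero] at hqt
    exact zero_ne_one hqt
  have hx : polyOfCoeffs (radialProj (s • v) hv0).1 = C (‖s • v‖⁻¹ * s) * q := by
    simp only [radialProj]
    rw [smul_smul, polyOfCoeffs_smul, hv]
  have hpos : 0 < ‖s • v‖⁻¹ := inv_pos.2 (norm_pos_iff.2 hv0)
  have he : (polyOfCoeffs (radialProj (s • v) hv0).1).eval t = ‖s • v‖⁻¹ * s := by
    rw [hx, eval_mul, eval_C, hqt, mul_one]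
  refine ⟨radialProj (s • v) hv0, ?_, ?_⟩
  · rw [monicShift, he, hx, shiftReflect_C_mul, hqp, ← mul_assoc, ← C_mul,
      inv_mul_cancel₀ (mul_ne_zero hpos.ne' hs), C_1, one_mul]
  · rw [he, mul_left_comm]
    exact mul_pos hpos (mul_self_pos.2 hs)

/-- Lying over `y` means proportionality with a positive factor: the monic equation records the
proportionality, the sign condition at `t` the positivity. -/
theorem mulSphere_eq_iff_monicShift {y : USphere (m + n)} (hy : (polyOfCoeffs y.1).eval t ≠ 0)
    (z : USphere m × USphere n) :
    mulSphere m n z = y ↔ 0 < (polyOfCoeffs z.1.1).eval t * (polyOfCoeffs z.2.1).eval t *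
        (polyOfCoeffs y.1).eval t ∧ monicShift t z.1 * monicShift t z.2 = monicShift t y := by
  have hT := shiftReflect_mul (polyOfCoeffs_natDegree_le z.1.1) (polyOfCoeffs_natDegree_le z.2.1) t
  rw [mulSphere_eq_iff]
  set a := (polyOfCoeffs z.1.1).eval t with ha
  set b := (polyOfCoeffs z.2.1).eval t with hb
  set g := (polyOfCoeffs y.1).eval t with hg
  constructor
  · rintro ⟨c, hc, h⟩
    have h1 : a * b = c * g := by
      have := congrArg (eval t) h
      simpa only [eval_mul, eval_C] using this
    have h2 : 0 < a * b * g := by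
      rw [h1, mul_assoc]
      exact mul_pos hc (mul_self_pos.2 hy)
    refine ⟨h2, ?_⟩
    rw [monicShift, monicShift, monicShift, ← ha, ← hb, ← hg, mul_mul_mul_comm, ← hT, h,
      shiftReflect_C_mul, ← C_mul, ← mul_assoc, ← C_mul, ← mul_inv, h1]
    congr 2
    field_simp
  · rintro ⟨h1, h2⟩
    have hab := left_ne_zero_of_mul h1.ne'
    refine ⟨a * b / g, ?_, ?_⟩
    · have : a * b / g = a * b * g / g ^ 2 := by field_simp
      rw [this]
      positivity
    · refine shiftReflect_injective (m + n) t ?_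
      rw [hT, shiftReflect_C_mul, ← C_eval_mul_monicShift (left_ne_zero_of_mul hab),
        ← C_eval_mul_monicShift (right_ne_zero_of_mul hab), mul_mul_mul_comm, h2, ← C_mul,
        ← C_eval_mul_monicShift hy, ← mul_assoc, ← C_mul, div_mul_cancel₀ _ hy]

/-- Normalization divides the resultant by an `n`-th and an `m`-th power, positive because both
exponents are even. -/
theorem sign_sphereResultant (hm : Even m) (hn : Even n) {z : USphere m × USphere n}
    (h1 : (polyOfCoeffs z.1.1).eval t ≠ 0) (h2 : (polyOfCoeffs z.2.1).eval t ≠ 0) :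
    (SignType.sign (sphereResultant z) : ℤ) =
      reflectSign m n * SignType.sign (resultant (monicShift t z.1) (monicShift t z.2)) := by
  have h := resultant_shiftReflect (polyOfCoeffs_natDegree_le z.1.1)
    (polyOfCoeffs_natDegree_le z.2.1) t
  rw [← C_eval_mul_monicShift h1, ← C_eval_mul_monicShift h2, resultant_C_mul_left,
    resultant_C_mul_right] at h
  rw [natDegree_monicShift h1, natDegree_monicShift h2]
  have h3 := congrArg (fun r : ℝ => (SignType.sign r : ℤ)) h
  simp only [sign_mul, sign_pos (hn.pow_pos h1), sign_pos (hm.pow_pos h2), one_mul] at h3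
  rw [h3, sphereResultant]
  rcases reflectSign_eq m n with h | h <;> simp [h]

/-- The points of the fibre over `y` whose first component is positive at `t`. -/
def positiveFibre (t : ℝ) (y : USphere (m + n)) : Set (USphere m × USphere n) :=
  {z | mulSphere m n z = y ∧ 0 < (polyOfCoeffs z.1.1).eval t}

theorem eval_ne_zero_of_mulSphere_eq {y : USphere (m + n)} (hy : (polyOfCoeffs y.1).eval t ≠ 0)
    {z : USphere m × USphere n} (hz : mulSphere m n z = y) :
    (polyOfCoeffs z.1.1).eval t ≠ 0 ∧ (polyOfCoeffs z.2.1).eval t ≠ 0 :=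
  mul_ne_zero_iff.1 (left_ne_zero_of_mul ((mulSphere_eq_iff_monicShift hy z).1 hz).1.ne')

theorem monicShift_mem_monicFactorPairs {y : USphere (m + n)}
    (hy : (polyOfCoeffs y.1).eval t ≠ 0) {z : USphere m × USphere n} (hz : mulSphere m n z = y) :
    (monicShift t z.1, monicShift t z.2) ∈ monicFactorPairs (monicShift t y) m := by
  obtain ⟨h1, h2⟩ := eval_ne_zero_of_mulSphere_eq hy hz
  exact ⟨monic_monicShift h1, monic_monicShift h2, ((mulSphere_eq_iff_monicShift hy z).1 hz).2,
    natDegree_monicShift h1⟩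

/-- Monic factors determine the points up to sign. Positivity at `t` fixes the first sign, and the
sign of `y` at `t` then forces the second. -/
theorem bijOn_monicShift {y : USphere (m + n)} (hy : (polyOfCoeffs y.1).eval t ≠ 0) :
    Set.BijOn (fun z : USphere m × USphere n => (monicShift t z.1, monicShift t z.2))
      (positiveFibre t y) (monicFactorPairs (monicShift t y) m) := by
  refine ⟨fun z hz => monicShift_mem_monicFactorPairs hy hz.1, ?_, ?_⟩
  · intro z hz z' hz' h
    have h1 := ((mulSphere_eq_iff_monicShift hy z).1 hz.1).1
    have h2 := ((mulSphere_eq_iff_monicShift hy z').1 hz'.1).1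
    refine Prod.ext (monicShift_injOn (mul_pos hz.2 hz'.2) (congrArg Prod.fst h))
      (monicShift_injOn ?_ (congrArg Prod.snd h))
    have h3 := mul_pos h1 h2
    rw [show ∀ a b g a' b' : ℝ, a * b * g * (a' * b' * g) = (b * b') * (a * a' * g ^ 2) from
      fun a b g a' b' => by ring] at h3
    exact pos_of_mul_pos_left h3 (mul_nonneg (mul_pos hz.2 hz'.2).le (sq_nonneg _))
  · rintro ⟨p, q⟩ ⟨hp, hq, hpq, hd⟩
    simp only at hp hq hpq hd
    have hd' : q.natDegree = n := by
      have := natDegree_monicShift hy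
      rw [← hpq, hp.natDegree_mul hq] at this
      omega
    obtain ⟨x, hx, hx'⟩ := exists_monicShift_eq (t := t) hp hd one_ne_zero
    rw [one_mul] at hx'
    obtain ⟨w, hw, hw'⟩ := exists_monicShift_eq (t := t) hq hd' hy
    refine ⟨(x, w), ⟨(mulSphere_eq_iff_monicShift hy (x, w)).2 ⟨?_, ?_⟩, hx'⟩, ?_⟩
    · rw [mul_assoc, mul_comm (eval t (polyOfCoeffs w.1))]
      exact mul_pos hx' hw'
    · simp only [hx, hw, hpq]
    · simp only [hx, hw]

theorem polyOfCoeffs_coe_neg (x : USphere m) : polyOfCoeffs (-x).1 = -polyOfCoeffs x.1 :=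
  (polyOfCoeffsₗ m).map_neg x.1

theorem sphereResultant_neg (hm : Even m) (hn : Even n) (z : USphere m × USphere n) :
    sphereResultant (-z) = sphereResultant z := by
  have h : ∀ (d : ℕ) (x : USphere d), polyOfCoeffs (-x).1 = C (-1) * polyOfCoeffs x.1 :=
    fun d x => by rw [polyOfCoeffs_coe_neg]; simp
  rw [sphereResultant, sphereResultant, Prod.fst_neg, Prod.snd_neg, h, h, resultant_C_mul_left,
    resultant_C_mul_right, hm.neg_one_pow, hn.neg_one_pow, one_mul, one_mul]

theorem mulSphere_neg (z : USphere m × USphere n) : mulSphere m n (-z) = mulSphere m n z := by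
  rw [mulSphere_eq_iff]
  obtain ⟨c, hc, h⟩ := (mulSphere_eq_iff z _).1 rfl
  exact ⟨c, hc, by rw [Prod.fst_neg, Prod.snd_neg, polyOfCoeffs_coe_neg, polyOfCoeffs_coe_neg,
    neg_mul_neg, h]⟩

theorem fibre_eq_union {y : USphere (m + n)} (hy : (polyOfCoeffs y.1).eval t ≠ 0) :
    mulSphere m n ⁻¹' {y} = positiveFibre t y ∪ Neg.neg '' positiveFibre t y := by
  ext z
  constructor
  · intro hz
    rcases (eval_ne_zero_of_mulSphere_eq hy hz).1.lt_or_gt with h | h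
    · refine Or.inr ⟨-z, ⟨(mulSphere_neg z).trans hz, ?_⟩, neg_neg z⟩
      rw [Prod.fst_neg, polyOfCoeffs_coe_neg, eval_neg]
      exact neg_pos.2 h
    · exact Or.inl ⟨hz, h⟩
  · rintro (hz | ⟨w, hw, rfl⟩)
    · exact hz.1
    · exact (mulSphere_neg w).trans hw.1

theorem disjoint_positiveFibre_neg (y : USphere (m + n)) :
    Disjoint (positiveFibre t y) (Neg.neg '' positiveFibre t y) := by
  rw [Set.disjoint_left]
  rintro _ hz ⟨w, hw, rfl⟩
  have h1 := hz.2
  have h2 := hw.2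
  rw [Prod.fst_neg, polyOfCoeffs_coe_neg, eval_neg] at h1
  linarith

theorem finite_positiveFibre {y : USphere (m + n)} (hy : (polyOfCoeffs y.1).eval t ≠ 0) :
    (positiveFibre t y).Finite :=
  (bijOn_monicShift hy).finite_iff_finite.2 (finite_monicFactorPairs (monic_monicShift hy).ne_zero m)

end MonicShift

/-! ### Finiteness of fibres, the signed count, and a regular value -/

theorem exists_eval_polyOfCoeffs_ne_zero {d : ℕ} (y : USphere d) :
    ∃ t, (polyOfCoeffs y.1).eval t ≠ 0 := by
  by_contra! h
  exact polyOfCoeffs_ne_zero (ne_zero_of_mem_unit_sphere y)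
    (Polynomial.funext fun t => by rw [h t, eval_zero])

theorem finite_fibre_mulSphere {m n : ℕ} (y : USphere (m + n)) :
    (mulSphere m n ⁻¹' {y}).Finite := by
  obtain ⟨t, hy⟩ := exists_eval_polyOfCoeffs_ne_zero y
  rw [fibre_eq_union hy]
  exact (finite_positiveFibre hy).union ((finite_positiveFibre hy).image _)

theorem finsum_localDegree_mulSphere (k l : ℕ) {y : USphere (2 * k + 2 * l)}
    (hreg : IsRegValue (mulSphere (2 * k) (2 * l)) y) :
    ∑ᶠ z ∈ mulSphere (2 * k) (2 * l) ⁻¹' {y}, localDegree (mulSphere (2 * k) (2 * l)) z =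
      productFrameSign (2 * k) (2 * l) * reflectSign (2 * k) (2 * l) *
        (2 * ((k + l).choose k : ℤ)) := by
  obtain ⟨t, hy⟩ := exists_eval_polyOfCoeffs_ne_zero y
  have hfin := finite_positiveFibre hy
  have hm : Even (2 * k) := even_two_mul k
  have hn : Even (2 * l) := even_two_mul l
  have hbij := bijOn_monicShift hy
  have hsign : ∀ z ∈ positiveFibre t y, localDegree (mulSphere (2 * k) (2 * l)) z =
      productFrameSign (2 * k) (2 * l) * reflectSign (2 * k) (2 * l) *
        SignType.sign (resultant (monicShift t z.1) (monicShift t z.2)) := fun z hz => by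
    obtain ⟨h1, h2⟩ := eval_ne_zero_of_mulSphere_eq hy hz.1
    rw [localDegree_mulSphere, sign_sphereResultant hm hn h1 h2, mul_assoc]
  have hneg : ∀ z, localDegree (mulSphere (2 * k) (2 * l)) (-z) =
      localDegree (mulSphere (2 * k) (2 * l)) z := fun z => by
    rw [localDegree_mulSphere, localDegree_mulSphere, sphereResultant_neg hm hn]
  -- Every monic factorization comes from a fibre point, where regularity makes the resultant
  -- nonzero.
  have hcop : ∀ d ∈ monicFactorPairs (monicShift t y) (2 * k), IsCoprime d.1 d.2 := by
    intro d hd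
    obtain ⟨z, hz, rfl⟩ := hbij.surjOn hd
    obtain ⟨h1, h2⟩ := eval_ne_zero_of_mulSphere_eq hy hz.1
    have h3 := (surjective_mfderiv_mulSphere_iff z).1 (hreg z hz.1)
    have h4 := sign_sphereResultant hm hn h1 h2
    by_contra hnc
    rw [resultant_eq_zero_iff.2 ⟨Or.inl (monic_monicShift h1).ne_zero, hnc⟩, sign_zero,
      SignType.coe_zero, mul_zero] at h4
    rcases h3.lt_or_gt with h | h
    · simp [sign_neg h] at h4
    · simp [sign_pos h] at h4
  have hsum : ∑ᶠ z ∈ positiveFibre t y, localDegree (mulSphere (2 * k) (2 * l)) z =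
      productFrameSign (2 * k) (2 * l) * reflectSign (2 * k) (2 * l) *
        ((k + l).choose k : ℤ) := by
    rw [finsum_mem_congr rfl hsign, ← mul_finsum_mem' _ _ hfin,
      ← sum_sign_resultant_monicFactorPairs k l (monic_monicShift hy)
        (by rw [natDegree_monicShift hy]; ring) hcop]
    congr 1
    exact finsum_mem_eq_of_bijOn _ hbij fun z _ => rfl
  rw [fibre_eq_union hy, finsum_mem_union (disjoint_positiveFibre_neg y) hfin (hfin.image _),
    finsum_mem_image neg_injective.injOn, finsum_mem_congr rfl fun z _ => hneg z, hsum]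
  ring

/-- A product of `m + n` distinct linear factors is separable, so all its factorizations are
coprime. Its full degree forces the factors to have degrees exactly `m` and `n`, so the formal
resultant is the actual one. -/
theorem exists_isRegValue_mulSphere (m n : ℕ) : ∃ y, IsRegValue (mulSphere m n) y := by
  set f : ℝ[X] := ∏ i : Fin (m + n), (X - C ((i : ℕ) : ℝ)) with hf
  have hsep : f.Separable := separable_prod_X_sub_C_iff.2 fun i j h =>
    Fin.ext (Nat.cast_injective h)
  have hdeg : f.natDegree = m + n := by
    rw [hf, natDegree_prod_of_monic _ _ fun i _ => monic_X_sub_C _]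
    simp only [natDegree_X_sub_C, Finset.sum_const, Finset.card_univ, Fintype.card_fin,
      smul_eq_mul, mul_one]
  set v : EuclideanSpace ℝ (Fin (m + n + 1)) := WithLp.toLp 2 fun i => f.coeff i
  have hv : polyOfCoeffs v = f := polyOfCoeffs_toLp_coeff hdeg.le
  have hv0 : v ≠ 0 := fun h => by
    rw [h, ← polyOfCoeffsₗ_apply, map_zero] at hv
    exact hsep.ne_zero hv.symm
  refine ⟨radialProj v hv0, fun z hz => (surjective_mfderiv_mulSphere_iff z).2 ?_⟩
  obtain ⟨c, hc, h⟩ := (mulSphere_eq_iff z _).1 hz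
  have h1 : polyOfCoeffs (radialProj v hv0).1 = C ‖v‖⁻¹ * f := by
    rw [radialProj, polyOfCoeffs_smul, hv]
  have hc' : c * ‖v‖⁻¹ ≠ 0 := mul_ne_zero hc.ne' (inv_ne_zero (norm_ne_zero_iff.2 hv0))
  rw [h1, ← mul_assoc, ← C_mul] at h
  have hcop : IsCoprime (polyOfCoeffs z.1.1) (polyOfCoeffs z.2.1) := by
    refine Separable.isCoprime ?_
    rw [h]
    exact hsep.unit_mul (isUnit_C.2 hc'.isUnit)
  have hd : (polyOfCoeffs z.1.1).natDegree + (polyOfCoeffs z.2.1).natDegree = m + n := by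
    rw [← natDegree_mul (polyOfCoeffs_ne_zero (ne_zero_of_mem_unit_sphere z.1))
      (polyOfCoeffs_ne_zero (ne_zero_of_mem_unit_sphere z.2)), h, natDegree_C_mul hc', hdeg]
  have hd1 := polyOfCoeffs_natDegree_le z.1.1
  have hd2 := polyOfCoeffs_natDegree_le z.2.1
  have := resultant_ne_zero _ _ hcop
  rwa [show (polyOfCoeffs z.1.1).natDegree = m by omega,
    show (polyOfCoeffs z.2.1).natDegree = n by omega] at this

end

theorem proposition8p5 (k l m n : ℕ) (hm : m = 2 * k) (hn : n = 2 * l) :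
    HasMappingDegree (mulSphere m n) (2 * ((k + l).choose k : ℤ)) ∨
      HasMappingDegree (mulSphere m n) (-(2 * ((k + l).choose k : ℤ))) := by
  subst hm hn
  have key : ∀ D : ℤ, D = productFrameSign (2 * k) (2 * l) * reflectSign (2 * k) (2 * l) *
      (2 * ((k + l).choose k : ℤ)) → HasMappingDegree (mulSphere (2 * k) (2 * l)) D := fun D hD =>
    ⟨(contMDiff_mulSphere _ _).of_le le_top, exists_isRegValue_mulSphere _ _,
      fun y _ => finite_fibre_mulSphere y, fun y hy => (finsum_localDegree_mulSphere k l hy).trans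
        hD.symm⟩
  rcases productFrameSign_eq (2 * k) (2 * l) with h | h <;>
    rcases reflectSign_eq (2 * k) (2 * l) with h' | h'
  · exact Or.inl (key _ (by rw [h, h']; ring))
  · exact Or.inr (key _ (by rw [h, h']; ring))
  · exact Or.inr (key _ (by rw [h, h']; ring))
  · exact Or.inl (key _ (by rw [h, h']; ring))
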